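/- **Setting.** Let $\mathbb X$ be a virtual equipment, that is, a virtual double category (objects, tight-cells forming a category, loose-cells, and 2-cells from chains of loose-cells to loose-cells framed by two tight-cells, with associative and unital composition) in which every object $A$ has a loose-identity $A(1,1)$ (given by an opcartesian 2-cell out of the empty chain) and every loose-cell has a restriction (given by a cartesian 2-cell) along every pair of tight-cells. For tight-cells $f\colon B\to E$ and $g\colon A\to E$ write $E(f,g)$ for the restriction of $E(1,1)$ along $f$ and $g$, a loose-cell from $A$ to $B$. A 2-cell $f\Rightarrow g$ between tight-cells $f,g\colon A\to E$ is a 2-cell from the empty chain at $A$ to $E(1,1)$ framed by $f$ and $g$, equivalently a globular 2-cell ${}\Rightarrow E(f,g)$ from the empty chain. Write $\cap_f\colon{}\Rightarrow E(f,f)$ for the 2-cell corresponding to the identity on $f$, and $\circ\colon E(f,g),E(g,h)\Rightarrow E(f,h)$ for the canonical composition 2-cell. Chains are written in the order of composition, so that the chain $E(f,g),E(g,h)$ runs from the domain of $h$ to the domain of $f$. * *Loose-monads.* A loose-monad on $A$ is a loose-cell $p$ from $A$ to $A$ with globular 2-cells $p,p\Rightarrow p$ and ${}\Rightarrow p$ that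 are associative and unital; a morphism of loose-monads on $A$ is a globular 2-cell commuting with these. A tight-cell $\ell\colon A\to C$ yields the loose-monad $C(\ell,\ell)$, with multiplication $\circ$ and unit $\cap_\ell$. A loose-monad on $A$ is *induced by* $\ell$ if it is isomorphic, as a loose-monad on $A$, to $C(\ell,\ell)$. * *Relative monads.* For a tight-cell $j\colon A\to E$, a $j$-monad $T=(t,\dagger,\eta)$ is a tight-cell $t\colon A\to E$, a 2-cell $\eta\colon j\Rightarrow t$ and a globular 2-cell $\dagger\colon E(j,t)\Rightarrow E(t,t)$ such that $\dagger$ followed by restriction along $\eta$, $E(t,t)\Rightarrow E(j,t)$, is the identity; $\eta$, seen as ${}\Rightarrow E(j,t)$, followed by $\dagger$ is $\cap_t$; and $\circ\,(\dagger,\dagger)=\dagger\,(\circ\,(1,\dagger))$ as 2-cells $E(j,t),E(j,t)\Rightarrow E(t,t)$. It induces the loose-monad $E(j,T)$ on $A$ with underlying loose-cell $E(j,t)$, unit $\eta\colon{}\Rightarrow E(j,t)$, and multiplication $E(j,t),E(j,t)\xrightarrow{1,\dagger}E(j,t),E(t,t)\xrightarrow{\circ}E(j,t)$. For $\ell\colon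 A\to C$, the trivial $\ell$-monad is $(\ell,1_{C(\ell,\ell)},1_\ell)$. * *Opalgebras.* A $T$-opalgebra with codomain $B$ is a tight-cell $a\colon A\to B$ with a globular 2-cell $\ltimes\colon E(j,t)\Rightarrow B(a,a)$ that carries the unit and the multiplication of $E(j,T)$ to $\cap_a$ and $\circ$. It determines an action $\rho_a\colon B(1,a),E(j,t)\xrightarrow{1,\ltimes}B(1,a),B(a,a)\xrightarrow{\circ}B(1,a)$. For $T$-opalgebras $a,a'$ with codomains $B,B'$ and a chain $p_1,\dots,p_n$ of loose-cells from $B$ to $B'$ ($n\ge0$), a $(p_1,\dots,p_n)$-graded morphism from $a$ to $a'$ is a globular 2-cell $\alpha\colon p_1,\dots,p_n,B(1,a)\Rightarrow B'(1,a')$ such that $\alpha\,(1,\dots,1,\rho_a)=\rho_{a'}\,(\alpha,1)$ as 2-cells out of $p_1,\dots,p_n,B(1,a),E(j,t)$. * *Opalgebra objects.* An opalgebra object for $T$ is a $T$-opalgebra $(k_T\colon A\to\mathbf{Opalg}(T),\ltimes_T)$ such that (1) for every $T$-opalgebra $(a,\ltimes)$ with codomain $B$ there is a unique tight-cell $[]_\ltimes\colon\mathbf{Opalg}(T)\to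 B$ with $[]_\ltimes\circ k_T=a$ and such that $\ltimes_T$ followed by the canonical 2-cell $\mathbf{Opalg}(T)(k_T,k_T)\Rightarrow B(a,a)$ induced by $[]_\ltimes$ is $\ltimes$; and (2) every graded morphism $\alpha\colon p_1,\dots,p_n,B(1,a)\Rightarrow B'(1,a')$ of $T$-opalgebras is the restriction along $k_T$ of a unique globular 2-cell $p_1,\dots,p_n,B(1,[]_{\ltimes})\Rightarrow B'(1,[]_{\ltimes'})$. * *Resolutions.* A relative adjunction $\ell\dashv_j r$, for $\ell\colon A\to C$ and $r\colon C\to E$, is an invertible globular 2-cell $\sharp\colon C(\ell,1)\cong E(j,r)$, with inverse $\flat$. It induces the $j$-monad with underlying tight-cell $r\ell$, with unit corresponding to ${}\xRightarrow{\cap_\ell}C(\ell,\ell)\xRightarrow{\sharp}E(j,r\ell)$, and with extension operator $E(j,r\ell)\xRightarrow{\flat}C(\ell,\ell)\xRightarrow{r}E(r\ell,r\ell)$. It is a resolution of $T$ if this $j$-monad is $T$. **Proposition.** Let $\mathbb X$ be a virtual equipment, let $j\colon A\to E$ be a tight-cell and let $T$ be a $j$-monad. 1. Suppose that the loose-monad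 $E(j,T)$ is induced by a tight-cell $\ell\colon A\to C$. Then $T$ admits an opalgebra object if and only if the trivial $\ell$-monad admits an opalgebra object. In that case, for all opalgebra objects $k_T\colon A\to\mathbf{Opalg}(T)$ of $T$ and $k_\ell\colon A\to\mathbf{Opalg}(\ell)$ of the trivial $\ell$-monad, there is an isomorphism (of objects, by tight-cells) $e\colon\mathbf{Opalg}(\ell)\cong\mathbf{Opalg}(T)$ with $e\circ k_\ell=k_T$. 2. If $T$ admits a resolution $\ell\dashv_j r$, then $E(j,T)$ is induced by $\ell$, so that the conclusions of 1 hold for this $\ell$. -/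

import Mathlib

open CategoryTheory

universe w z v u

/-- Finite chains of composable loose-cells, read from left to right. -/
inductive LoosePath {X : Type u} (L : X → X → Type w) : X → X → Type (max u w)
  | nil (A : X) : LoosePath L A A
  | cons {A B C : X} (p : L A B) (P : LoosePath L B C) : LoosePath L A C

namespace LoosePath

variable {X : Type u} {L : X → X → Type w}

/-- Concatenation of chains of loose-cells. -/
@[reducible] def append : {A B C : X} → LoosePath L A B → LoosePath L B C → LoosePath L A C
  | _, _, _, nil _, Q => Q
  | _, _, _, cons p P, Q => cons p (append P Q)

/-- The chain consisting of one loose-cell. -/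
abbrev single {A B : X} (p : L A B) : LoosePath L A B := cons p (nil B)

theorem append_nil : {A B : X} → (P : LoosePath L A B) → P.append (nil B) = P
  | _, _, nil _ => rfl
  | _, _, cons p P => congrArg (cons p) (append_nil P)

theorem append_assoc : {A B C D : X} → (P : LoosePath L A B) → (Q : LoosePath L B C) →
    (R : LoosePath L C D) → (P.append Q).append R = P.append (Q.append R)
  | _, _, _, _, nil _, _, _ => rfl
  | _, _, _, _, cons p P, Q, R => congrArg (cons p) (append_assoc P Q R)

end LoosePath

/-- The loose-cells and 2-cells of a virtual double category whose objects and tight-cells are those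
of the category `X`. A 2-cell in `Cell f g P q` has left leg `f`, right leg `g`, the chain `P` as its
top and the loose-cell `q` as its bottom. -/
structure CellData (X : Type u) [Category.{v} X] where
  Loose : X → X → Type w
  Cell : {A B A' B' : X} → (A ⟶ A') → (B ⟶ B') → LoosePath Loose A B → Loose A' B' → Type z

namespace CellData

variable {X : Type u} [Category.{v} X]

/-- Horizontally composable rows of 2-cells: `D.Chain f g P Q` consists of the rows with left leg
`f` and right leg `g`, with one 2-cell over each loose-cell of `Q`, the concatenation of
whose tops is `P`. An empty row is a tight-cell. -/
inductive Chain (D : CellData.{w, z} X) : {A B A' B' : X} → (A ⟶ A') → (B ⟶ B') →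
    LoosePath D.Loose A B → LoosePath D.Loose A' B' → Type (max u v w z)
  | nil {A A' : X} (f : A ⟶ A') : Chain D f f (LoosePath.nil A) (LoosePath.nil A')
  | cons {A B C A' B' C' : X} {f : A ⟶ A'} {g : B ⟶ B'} {h : C ⟶ C'}
      {P : LoosePath D.Loose A B} {Q : LoosePath D.Loose B C} {S : LoosePath D.Loose A C}
      {q : D.Loose A' B'} {R : LoosePath D.Loose B' C'}
      (hS : S = P.append Q) (α : D.Cell f g P q) (αs : Chain D g h Q R) :
      Chain D f h S (LoosePath.cons q R)

variable {D : CellData.{w, z} X}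

/-- The row consisting of one 2-cell. -/
def Chain.single {A B A' B' : X} {f : A ⟶ A'} {g : B ⟶ B'} {P : LoosePath D.Loose A B}
    {q : D.Loose A' B'} (α : D.Cell f g P q) : D.Chain f g P (LoosePath.single q) :=
  .cons P.append_nil.symm α (.nil g)

/-- Juxtaposition of rows. -/
def Chain.append : {A B C A' B' C' : X} → {f : A ⟶ A'} → {g : B ⟶ B'} → {h : C ⟶ C'} →
    {P : LoosePath D.Loose A B} → {P' : LoosePath D.Loose B C} →
    {Q : LoosePath D.Loose A' B'} → {Q' : LoosePath D.Loose B' C'} →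
    D.Chain f g P Q → D.Chain g h P' Q' → D.Chain f h (P.append P') (Q.append Q')
  | _, _, _, _, _, _, _, _, _, _, _, _, _, .nil _, βs => βs
  | _, _, _, _, _, _, _, _, _, _, P', _, _, .cons hS α αs, βs =>
      .cons (by rw [hS, LoosePath.append_assoc]) α (αs.append βs)

/-- Transport of a row along equations of chains of loose-cells. -/
def Chain.cast {A B A' B' : X} {f : A ⟶ A'} {g : B ⟶ B'} {P P' : LoosePath D.Loose A B}
    {Q Q' : LoosePath D.Loose A' B'} (hP : P' = P) (hQ : Q' = Q) (αs : D.Chain f g P Q) :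
    D.Chain f g P' Q' := by
  subst hP hQ
  exact αs

/-- Two rows of 2-cells stacked on top of each other: a row `β₁, …, βₙ` together with, for each `i`,
a row `αs` placed on top of `βᵢ`. The upper row leads from `P` to `Q` with legs `f` and `g`, and the
lower row leads from `Q` to `R` with legs `f'` and `g'`. -/
inductive Stack (D : CellData.{w, z} X) : {A B A' B' A'' B'' : X} → (A ⟶ A') → (A' ⟶ A'') →
    (B ⟶ B') → (B' ⟶ B'') → LoosePath D.Loose A B → LoosePath D.Loose A' B' →
    LoosePath D.Loose A'' B'' → Type (max u v w z)
  | nil {A A' A'' : X} (f : A ⟶ A') (f' : A' ⟶ A'') :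
      Stack D f f' f f' (LoosePath.nil A) (LoosePath.nil A') (LoosePath.nil A'')
  | cons {A B C A' B' C' A'' B'' C'' : X} {f : A ⟶ A'} {f' : A' ⟶ A''} {g : B ⟶ B'} {g' : B' ⟶ B''}
      {h : C ⟶ C'} {h' : C' ⟶ C''} {P₁ : LoosePath D.Loose A B} {P₂ : LoosePath D.Loose B C}
      {Q₁ : LoosePath D.Loose A' B'} {Q₂ : LoosePath D.Loose B' C'} {P : LoosePath D.Loose A C}
      {Q : LoosePath D.Loose A' C'} {r : D.Loose A'' B''} {R : LoosePath D.Loose B'' C''}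
      (hP : P = P₁.append P₂) (hQ : Q = Q₁.append Q₂) (αs : D.Chain f g P₁ Q₁) (β : D.Cell f' g' Q₁ r)
      (τ : Stack D g g' h h' P₂ Q₂ R) :
      Stack D f f' h h' P Q (LoosePath.cons r R)

/-- The upper row of a stack. -/
def Stack.top : {A B A' B' A'' B'' : X} → {f : A ⟶ A'} → {f' : A' ⟶ A''} →
    {g : B ⟶ B'} → {g' : B' ⟶ B''} → {P : LoosePath D.Loose A B} → {Q : LoosePath D.Loose A' B'} →
    {R : LoosePath D.Loose A'' B''} → D.Stack f f' g g' P Q R → D.Chain f g P Q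
  | _, _, _, _, _, _, _, _, _, _, _, _, _, .nil f _ => .nil f
  | _, _, _, _, _, _, _, _, _, _, _, _, _, .cons hP hQ αs _ τ =>
      (αs.append τ.top).cast hP hQ

/-- The lower row of a stack. -/
def Stack.bottom : {A B A' B' A'' B'' : X} → {f : A ⟶ A'} → {f' : A' ⟶ A''} →
    {g : B ⟶ B'} → {g' : B' ⟶ B''} → {P : LoosePath D.Loose A B} → {Q : LoosePath D.Loose A' B'} →
    {R : LoosePath D.Loose A'' B''} → D.Stack f f' g g' P Q R → D.Chain f' g' Q R
  | _, _, _, _, _, _, _, _, _, _, _, _, _, .nil _ f' => .nil f'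
  | _, _, _, _, _, _, _, _, _, _, _, _, _, .cons _ hQ _ β τ => .cons hQ β τ.bottom

end CellData

/-- Identity 2-cells and composition of 2-cells, without laws. The composite of a row with a 2-cell
has the composites of the legs as its legs; these are given by names `f''` and `g''` with proofs
that they are the composites, so that no transport along equations of tight-cells is needed. -/
structure CellOperations (X : Type u) [Category.{v} X] extends CellData.{w, z} X where
  id : {A B : X} → (p : Loose A B) → Cell (𝟙 A) (𝟙 B) (LoosePath.single p) p
  comp : {A B A' B' A'' B'' : X} → {f : A ⟶ A'} → {f' : A' ⟶ A''} → {f'' : A ⟶ A''} →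
    {g : B ⟶ B'} → {g' : B' ⟶ B''} → {g'' : B ⟶ B''} → {P : LoosePath Loose A B} →
    {Q : LoosePath Loose A' B'} → {r : Loose A'' B''} → f ≫ f' = f'' → g ≫ g' = g'' →
    toCellData.Chain f g P Q → Cell f' g' Q r → Cell f'' g'' P r

namespace CellOperations

variable {X : Type u} [Category.{v} X] (D : CellOperations.{w, z} X)

/-- The row of identity 2-cells on a chain of loose-cells. -/
def ids : {A B : X} → (P : LoosePath D.Loose A B) → D.Chain (𝟙 A) (𝟙 B) P P
  | _, _, .nil A => .nil (𝟙 A)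
  | _, _, .cons p P => .cons rfl (D.id p) (ids P)

/-- The row obtained from a stack by composing each `βᵢ` with the row on top of it. -/
def compStack : {A B A' B' A'' B'' : X} → {f : A ⟶ A'} → {f' : A' ⟶ A''} →
    {g : B ⟶ B'} → {g' : B' ⟶ B''} → {P : LoosePath D.Loose A B} → {Q : LoosePath D.Loose A' B'} →
    {R : LoosePath D.Loose A'' B''} → D.Stack f f' g g' P Q R → D.Chain (f ≫ f') (g ≫ g') P R
  | _, _, _, _, _, _, _, _, _, _, _, _, _, .nil f f' => .nil (f ≫ f')
  | _, _, _, _, _, _, _, _, _, _, _, _, _, .cons hP _ αs β τ =>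
      .cons hP (D.comp rfl rfl αs β) (compStack τ)

end CellOperations

/-- Virtual double categories whose category of objects and tight-cells is `X`. -/
structure VirtualDoubleCategory (X : Type u) [Category.{v} X] extends CellOperations.{w, z} X where
  comp_id : ∀ {A B A' B' : X} {f : A ⟶ A'} {g : B ⟶ B'} {P : LoosePath Loose A B}
    {q : Loose A' B'} (α : Cell f g P q),
    comp (Category.comp_id f) (Category.comp_id g) (.single α) (id q) = α
  id_comp : ∀ {A B A' B' : X} {f : A ⟶ A'} {g : B ⟶ B'} {P : LoosePath Loose A B}
    {q : Loose A' B'} (α : Cell f g P q),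
    comp (Category.id_comp f) (Category.id_comp g) (toCellOperations.ids P) α = α
  assoc : ∀ {A B A' B' A'' B'' A₃ B₃ : X} {f : A ⟶ A'} {f' : A' ⟶ A''} {g : B ⟶ B'}
    {g' : B' ⟶ B''} {f'' : A'' ⟶ A₃} {g'' : B'' ⟶ B₃} {P : LoosePath Loose A B}
    {Q : LoosePath Loose A' B'} {R : LoosePath Loose A'' B''} {s : Loose A₃ B₃}
    (τ : toCellData.Stack f f' g g' P Q R) (γ : Cell f'' g'' R s),
    comp (Category.assoc f f' f'') (Category.assoc g g' g'') (toCellOperations.compStack τ) γ =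
      comp rfl rfl τ.top (comp rfl rfl τ.bottom γ)

namespace VirtualDoubleCategory

variable {X : Type u} [Category.{v} X] (𝕏 : VirtualDoubleCategory.{w, z} X)

/-- The 2-cells `P ⇒ q` whose legs are identities. -/
abbrev Globular {A B : X} (P : LoosePath 𝕏.Loose A B) (q : 𝕏.Loose A B) : Type z :=
  𝕏.Cell (𝟙 A) (𝟙 B) P q

variable {𝕏}

/-- Composition of 2-cells whose legs are identities. -/
abbrev gcomp {A B : X} {P Q : LoosePath 𝕏.Loose A B} {r : 𝕏.Loose A B}
    (αs : 𝕏.Chain (𝟙 A) (𝟙 B) P Q) (β : 𝕏.Globular Q r) : 𝕏.Globular P r :=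
  𝕏.comp (Category.id_comp _) (Category.id_comp _) αs β

/-- Composition of a 2-cell with a 2-cell whose top is a single loose-cell, the legs of both being
identities. -/
abbrev vcomp {A B : X} {P : LoosePath 𝕏.Loose A B} {q r : 𝕏.Loose A B}
    (α : 𝕏.Globular P q) (β : 𝕏.Globular (.single q) r) : 𝕏.Globular P r :=
  gcomp (.single α) β

/-- The row of two 2-cells. -/
abbrev pair {A B C A' B' C' : X} {f : A ⟶ A'} {g : B ⟶ B'} {h : C ⟶ C'}
    {P : LoosePath 𝕏.Loose A B} {Q : LoosePath 𝕏.Loose B C} {p : 𝕏.Loose A' B'}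
    {q : 𝕏.Loose B' C'} (α : 𝕏.Cell f g P p) (β : 𝕏.Cell g h Q q) :
    𝕏.Chain f h (P.append Q) (.cons p (.single q)) :=
  .cons rfl α (.single β)

/-- A 2-cell `κ` is opcartesian if each 2-cell whose top contains the top of `κ` as a segment factors
uniquely through `κ` (juxtaposed with identities). -/
def IsOpcartesian {A B : X} {Q : LoosePath 𝕏.Loose A B} {q : 𝕏.Loose A B}
    (κ : 𝕏.Globular Q q) : Prop :=
  ∀ ⦃Y Z Y' Z' : X⦄ (R : LoosePath 𝕏.Loose Y A) (P : LoosePath 𝕏.Loose B Z) (f : Y ⟶ Y')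
    (g : Z ⟶ Z') (s : 𝕏.Loose Y' Z') (φ : 𝕏.Cell f g (R.append (Q.append P)) s),
    ∃! ψ : 𝕏.Cell f g (R.append (.cons q P)) s,
      𝕏.comp (Category.id_comp f) (Category.id_comp g)
        ((𝕏.ids R).append (.cons rfl κ (𝕏.ids P))) ψ = φ

/-- A 2-cell `κ` with top a single loose-cell is cartesian if each 2-cell with the same bottom, whose
legs factor through those of `κ`, factors uniquely through `κ`. -/
def IsCartesian {A B A' B' : X} {f : A ⟶ A'} {g : B ⟶ B'} {p : 𝕏.Loose A B} {q : 𝕏.Loose A' B'}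
    (κ : 𝕏.Cell f g (.single p) q) : Prop :=
  ∀ ⦃Y Z : X⦄ (R : LoosePath 𝕏.Loose Y Z) (f' : Y ⟶ A) (g' : Z ⟶ B)
    (φ : 𝕏.Cell (f' ≫ f) (g' ≫ g) R q),
    ∃! ψ : 𝕏.Cell f' g' R p, 𝕏.comp rfl rfl (.single ψ) κ = φ

end VirtualDoubleCategory

/-- A loose-monad on `A`. -/
structure LooseMonad {X : Type u} [Category.{v} X] (𝕏 : VirtualDoubleCategory.{w, z} X) (A : X) where
  t : 𝕏.Loose A A
  mul : 𝕏.Globular (.cons t (.single t)) t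
  unit : 𝕏.Globular (.nil A) t
  mul_assoc : VirtualDoubleCategory.gcomp (VirtualDoubleCategory.pair mul (𝕏.id t)) mul = VirtualDoubleCategory.gcomp (VirtualDoubleCategory.pair (𝕏.id t) mul) mul
  unit_mul : VirtualDoubleCategory.gcomp (VirtualDoubleCategory.pair unit (𝕏.id t)) mul = 𝕏.id t
  mul_unit : VirtualDoubleCategory.gcomp (VirtualDoubleCategory.pair (𝕏.id t) unit) mul = 𝕏.id t

/-- Virtual equipments, with chosen loose-identities `unit A` (exhibited by the opcartesian
2-cells `unitCell A`) and chosen restrictions `restr q g f` of loose-cells `q` along tight-cells, where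
`f` is the left leg and `g` the right leg of the cartesian 2-cell. -/
structure VirtualEquipment (X : Type u) [Category.{v} X] extends
    VirtualDoubleCategory.{w, z} X where
  unit : (A : X) → Loose A A
  unitCell : (A : X) → Cell (𝟙 A) (𝟙 A) (.nil A) (unit A)
  unitCell_opcartesian : ∀ A : X,
    VirtualDoubleCategory.IsOpcartesian (𝕏 := toVirtualDoubleCategory) (unitCell A)
  restr : {A B A' B' : X} → Loose A' B' → (B ⟶ B') → (A ⟶ A') → Loose A B
  restrCell : {A B A' B' : X} → (q : Loose A' B') → (g : B ⟶ B') → (f : A ⟶ A') →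
    Cell f g (.single (restr q g f)) q
  restrCell_cartesian : ∀ {A B A' B' : X} (q : Loose A' B') (g : B ⟶ B') (f : A ⟶ A'),
    VirtualDoubleCategory.IsCartesian (𝕏 := toVirtualDoubleCategory) (restrCell q g f)

namespace VirtualEquipment

open VirtualDoubleCategory

variable {X : Type u} [Category.{v} X] (𝕏 : VirtualEquipment.{w, z} X)

/-- The loose-cell `E(f, g)`: the restriction of the loose-identity of `E` along `f` (on the
right) and `g` (on the left). -/
def hom {A B E : X} (f : B ⟶ E) (g : A ⟶ E) : 𝕏.Loose A B := 𝕏.restr (𝕏.unit E) f g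

/-- The cartesian 2-cell of `E(f, g)`. -/
def homCell {A B E : X} (f : B ⟶ E) (g : A ⟶ E) :
    𝕏.Cell g f (.single (𝕏.hom f g)) (𝕏.unit E) :=
  𝕏.restrCell (𝕏.unit E) f g

/-- The 2-cells `f ⇒ g` between tight-cells: nullary 2-cells into a loose-identity with right leg
`f` and left leg `g`. -/
abbrev TwoCell {A B : X} (f g : A ⟶ B) : Type z := 𝕏.Cell g f (.nil A) (𝕏.unit B)

/-- The identity 2-cell `1_f : f ⇒ f`. -/
def tightId {A B : X} (f : A ⟶ B) : 𝕏.TwoCell f f :=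
  𝕏.comp (Category.comp_id f) (Category.comp_id f) (.nil f) (𝕏.unitCell B)

variable {𝕏}

theorem exists_lift {A B E Y Z : X} {f : B ⟶ E} {g : A ⟶ E} {R : LoosePath 𝕏.Loose Y Z}
    {g' : Y ⟶ A} {f' : Z ⟶ B} {g'' : Y ⟶ E} {f'' : Z ⟶ E} (hg : g' ≫ g = g'') (hf : f' ≫ f = f'')
    (φ : 𝕏.Cell g'' f'' R (𝕏.unit E)) :
    ∃! ψ : 𝕏.Cell g' f' R (𝕏.hom f g), 𝕏.comp hg hf (.single ψ) (𝕏.homCell f g) = φ := by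
  subst hg hf
  exact 𝕏.restrCell_cartesian (𝕏.unit E) f g R g' f' φ

/-- The factorisation of a 2-cell through the cartesian 2-cell of `E(f, g)`. -/
noncomputable def lift {A B E Y Z : X} {f : B ⟶ E} {g : A ⟶ E} {R : LoosePath 𝕏.Loose Y Z}
    {g' : Y ⟶ A} {f' : Z ⟶ B} {g'' : Y ⟶ E} {f'' : Z ⟶ E} (hg : g' ≫ g = g'') (hf : f' ≫ f = f'')
    (φ : 𝕏.Cell g'' f'' R (𝕏.unit E)) : 𝕏.Cell g' f' R (𝕏.hom f g) :=
  (exists_lift hg hf φ).choose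

/-- The 2-cell `P ⇒ E(f, g)` corresponding to a 2-cell from `P` to the loose-identity of `E` with
left leg `g` and right leg `f`. -/
noncomputable abbrev toHom {A B E : X} {f : B ⟶ E} {g : A ⟶ E} {P : LoosePath 𝕏.Loose A B}
    (φ : 𝕏.Cell g f P (𝕏.unit E)) : 𝕏.Globular P (𝕏.hom f g) :=
  lift (Category.id_comp g) (Category.id_comp f) φ

/-- The 2-cell from `P` to the loose-identity of `E` with left leg `g` and right leg `f` that
corresponds to a 2-cell `P ⇒ E(f, g)`. -/
abbrev ofHom {A B E : X} {f : B ⟶ E} {g : A ⟶ E} {P : LoosePath 𝕏.Loose A B}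
    (ψ : 𝕏.Globular P (𝕏.hom f g)) : 𝕏.Cell g f P (𝕏.unit E) :=
  𝕏.comp (Category.id_comp g) (Category.id_comp f) (.single ψ) (𝕏.homCell f g)

variable (𝕏)

/-- The canonical 2-cell `A(1, 1), A(1, 1) ⇒ A(1, 1)`, the factorisation of the identity
through the opcartesian 2-cell of `A(1, 1)`. -/
noncomputable def unitMul (A : X) :
    𝕏.Globular (.cons (𝕏.unit A) (.single (𝕏.unit A))) (𝕏.unit A) :=
  (𝕏.unitCell_opcartesian A (.nil A) (.single (𝕏.unit A)) (𝟙 A) (𝟙 A) (𝕏.unit A)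
    (𝕏.id (𝕏.unit A))).choose

/-- The action of a tight-cell `f : A ⟶ B` on loose-identities: the 2-cell `A(1, 1) ⇒ B(1, 1)` with
both legs `f` whose composite with the opcartesian 2-cell of `A(1, 1)` is `1_f`. -/
noncomputable def unitMap {A B : X} (f : A ⟶ B) :
    𝕏.Cell f f (.single (𝕏.unit A)) (𝕏.unit B) :=
  (𝕏.unitCell_opcartesian A (.nil A) (.nil A) f f (𝕏.unit B) (𝕏.tightId f)).choose

variable {𝕏}

/-- Horizontal composition of 2-cells into the loose-identity of `E`. -/
noncomputable def hcomp {A B C E : X} {f : A ⟶ E} {g : B ⟶ E} {h : C ⟶ E}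
    {P : LoosePath 𝕏.Loose A B} {Q : LoosePath 𝕏.Loose B C} {S : LoosePath 𝕏.Loose A C}
    (hS : S = P.append Q)
    (α : 𝕏.Cell f g P (𝕏.unit E)) (β : 𝕏.Cell g h Q (𝕏.unit E)) : 𝕏.Cell f h S (𝕏.unit E) :=
  𝕏.comp (Category.comp_id f) (Category.comp_id h) (.cons hS α (.single β)) (𝕏.unitMul E)

variable (𝕏)

/-- The composition 2-cell `E(g, h), E(f, g) ⇒ E(f, h)` (chains being read from left to
right). In terms of the counit `∪g : E(g, 1), E(1, g) ⇒ E(1, 1)` it is `E(f, 1), ∪g, E(1, h)`. -/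
noncomputable def homComp {A B C E : X} (f : C ⟶ E) (g : B ⟶ E) (h : A ⟶ E) :
    𝕏.Globular (.cons (𝕏.hom g h) (.single (𝕏.hom f g))) (𝕏.hom f h) :=
  toHom (hcomp rfl (𝕏.homCell g h) (𝕏.homCell f g))

/-- The unit `∩f : ⇒ B(f, f)` of a tight-cell `f : A ⟶ B`. -/
noncomputable def homUnit {A B : X} (f : A ⟶ B) : 𝕏.Globular (.nil A) (𝕏.hom f f) :=
  toHom (𝕏.tightId f)

variable {𝕏}

/-- The 2-cell `E(η, g) : E(f', g) ⇒ E(f, g)` for `η : f ⇒ f'`. -/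
noncomputable def homMap {A B E : X} {f f' : B ⟶ E} (η : 𝕏.TwoCell f f') (g : A ⟶ E) :
    𝕏.Globular (.single (𝕏.hom f' g)) (𝕏.hom f g) :=
  toHom (hcomp rfl (𝕏.homCell f' g) η)

/-- The 2-cell `φ ≫ k : P ⇒ D(k f, k g)` obtained from `φ : P ⇒ C(f, g)` and a tight-cell
`k : C ⟶ D`. -/
noncomputable def mapHom {A B C D : X} {f : B ⟶ C} {g : A ⟶ C} {P : LoosePath 𝕏.Loose A B}
    (φ : 𝕏.Globular P (𝕏.hom f g)) (k : C ⟶ D) {f' : B ⟶ D} {g' : A ⟶ D} (hf : f ≫ k = f')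
    (hg : g ≫ k = g') : 𝕏.Globular P (𝕏.hom f' g') :=
  toHom (𝕏.comp hg hf (.single (ofHom φ)) (𝕏.unitMap k))

/-- The 2-cell `E(f, g k) ⇒ E(f, g)` with left leg `k` and identity right leg, by which
`E(f, g k)` is a restriction of `E(f, g)`. -/
noncomputable def homRestr {A B C E : X} (k : A ⟶ B) (g : B ⟶ E) (f : C ⟶ E) {g' : A ⟶ E}
    (hg : k ≫ g = g') : 𝕏.Cell k (𝟙 C) (.single (𝕏.hom f g')) (𝕏.hom f g) :=
  lift hg (Category.id_comp f) (𝕏.homCell f g')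

/-- The 2-cell `E(f, g k), pₙ, …, p₁ ⇒ E'(f', g' k)` obtained by restricting a 2-cell
`β : E(f, g), pₙ, …, p₁ ⇒ E'(f', g')` along the tight-cell `k`. -/
noncomputable def restrictAlong {A B C C' E E' : X} (k : A ⟶ B) {f : C ⟶ E} {g : B ⟶ E}
    {f' : C' ⟶ E'} {g' : B ⟶ E'} {x : A ⟶ E} {x' : A ⟶ E'} (hx : k ≫ g = x) (hx' : k ≫ g' = x')
    {p : LoosePath 𝕏.Loose C C'} (β : 𝕏.Globular (.cons (𝕏.hom f g) p) (𝕏.hom f' g')) :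
    𝕏.Globular (.cons (𝕏.hom f x) p) (𝕏.hom f' x') :=
  toHom (𝕏.comp hx' (Category.id_comp f')
    (.single (𝕏.comp (Category.comp_id k) (Category.id_comp (𝟙 C'))
      (.cons rfl (homRestr k g f hx) (𝕏.ids p)) β))
    (𝕏.homCell f' g'))

end VirtualEquipment

open VirtualDoubleCategory VirtualEquipment

namespace CellData

variable {X : Type u} [Category.{v} X] {D : CellData.{w, z} X}

theorem Chain.cast_cons {A B C A' B' C' : X} {f : A ⟶ A'} {g : B ⟶ B'} {h : C ⟶ C'}
    {P : LoosePath D.Loose A B} {Q Q' : LoosePath D.Loose B C} {S S' : LoosePath D.Loose A C}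
    {q : D.Loose A' B'} {R R' : LoosePath D.Loose B' C'} (hS : S = P.append Q)
    (α : D.Cell f g P q) (αs : D.Chain g h Q R) (hS' : S' = S) (hQ : Q' = Q) (hR : R' = R)
    (hR' : LoosePath.cons q R' = LoosePath.cons q R) :
    (Chain.cons hS α αs).cast hS' hR' =
      Chain.cons (by rw [hS', hS, hQ]) α (αs.cast hQ hR) := by
  subst hS' hQ hR
  rfl

theorem Chain.cast_append_nil {A B A' B' : X} {f : A ⟶ A'} {g : B ⟶ B'}
    {P : LoosePath D.Loose A B} {Q : LoosePath D.Loose A' B'} (αs : D.Chain f g P Q)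
    (hP : P = P.append (.nil B)) (hQ : Q = Q.append (.nil B')) :
    (αs.append (.nil g)).cast hP hQ = αs := by
  induction αs with
  | nil f => rfl
  | cons hS α αs ih =>
    exact (Chain.cast_cons _ _ _ hP (LoosePath.append_nil _).symm (LoosePath.append_nil _).symm
      hQ).trans (by rw [ih])

end CellData

namespace VirtualDoubleCategory

variable {X : Type u} [Category.{v} X] {𝕏 : VirtualDoubleCategory.{w, z} X}

theorem comp_single_comp {A B A' B' A₂ B₂ A₃ B₃ : X} {f : A ⟶ A'} {f' : A' ⟶ A₂} {f₂ : A ⟶ A₂}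
    {g : B ⟶ B'} {g' : B' ⟶ B₂} {g₂ : B ⟶ B₂} {h : A₂ ⟶ A₃} {k : B₂ ⟶ B₃} {x : A ⟶ A₃} {y : B ⟶ B₃}
    {x' : A' ⟶ A₃} {y' : B' ⟶ B₃}
    {P : LoosePath 𝕏.Loose A B} {Q : LoosePath 𝕏.Loose A' B'} {r : 𝕏.Loose A₂ B₂} {s : 𝕏.Loose A₃ B₃}
    (hf : f ≫ f' = f₂) (hg : g ≫ g' = g₂) (hx : f₂ ≫ h = x) (hy : g₂ ≫ k = y)
    (hx' : f' ≫ h = x') (hy' : g' ≫ k = y') (hx₂ : f ≫ x' = x) (hy₂ : g ≫ y' = y)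
    (αs : 𝕏.Chain f g P Q) (β : 𝕏.Cell f' g' Q r) (γ : 𝕏.Cell h k (.single r) s) :
    𝕏.comp hx hy (.single (𝕏.comp hf hg αs β)) γ =
      𝕏.comp hx₂ hy₂ αs (𝕏.comp hx' hy' (.single β) γ) := by
  subst hf hg hx' hy'
  have := 𝕏.assoc (.cons (LoosePath.append_nil P).symm (LoosePath.append_nil Q).symm αs β
    (.nil g g')) γ
  simp only [CellData.Stack.top, CellData.Chain.cast_append_nil] at this
  subst hx₂ hy₂
  exact this

theorem comp_pair_comp {A B C A' B' C' A₂ B₂ C₂ A₃ C₃ : X} {f : A ⟶ A'} {f' : A' ⟶ A₂} {f₂ : A ⟶ A₂}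
    {g : B ⟶ B'} {g' : B' ⟶ B₂} {g₂ : B ⟶ B₂} {h : C ⟶ C'} {h' : C' ⟶ C₂} {h₂ : C ⟶ C₂}
    {k : A₂ ⟶ A₃} {l : C₂ ⟶ C₃} {x : A ⟶ A₃} {y : C ⟶ C₃} {x' : A' ⟶ A₃} {y' : C' ⟶ C₃}
    {P : LoosePath 𝕏.Loose A B} {P' : LoosePath 𝕏.Loose B C} {S : LoosePath 𝕏.Loose A C}
    {Q : LoosePath 𝕏.Loose A' B'} {Q' : LoosePath 𝕏.Loose B' C'} {S' : LoosePath 𝕏.Loose A' C'}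
    {r : 𝕏.Loose A₂ B₂} {r' : 𝕏.Loose B₂ C₂} {s : 𝕏.Loose A₃ C₃}
    (hS : S = P.append P') (hS' : S' = Q.append Q')
    (hf : f ≫ f' = f₂) (hg : g ≫ g' = g₂) (hh : h ≫ h' = h₂) (hx : f₂ ≫ k = x) (hy : h₂ ≫ l = y)
    (hx' : f' ≫ k = x') (hy' : h' ≫ l = y') (hx₂ : f ≫ x' = x) (hy₂ : h ≫ y' = y)
    (αs : 𝕏.Chain f g P Q) (αs' : 𝕏.Chain g h P' Q') (β : 𝕏.Cell f' g' Q r)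
    (β' : 𝕏.Cell g' h' Q' r') (γ : 𝕏.Cell k l (.cons r (.single r')) s) :
    𝕏.comp hx hy (.cons hS (𝕏.comp hf hg αs β) (.single (𝕏.comp hg hh αs' β'))) γ =
      𝕏.comp hx₂ hy₂ ((αs.append αs').cast hS hS')
        (𝕏.comp hx' hy' (.cons hS' β (.single β')) γ) := by
  subst hf hg hh hx' hy' hx₂ hy₂
  have := 𝕏.assoc (.cons hS hS' αs β (.cons (LoosePath.append_nil P').symm
    (LoosePath.append_nil Q').symm αs' β' (.nil h h'))) γ
  simp only [CellData.Stack.top, CellData.Chain.cast_append_nil] at this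
  exact this

end VirtualDoubleCategory

namespace VirtualEquipment

variable {X : Type u} [Category.{v} X] {𝕏 : VirtualEquipment.{w, z} X}

theorem ofHom_toHom {A B E : X} {f : B ⟶ E} {g : A ⟶ E} {P : LoosePath 𝕏.Loose A B}
    (φ : 𝕏.Cell g f P (𝕏.unit E)) : ofHom (toHom φ) = φ :=
  (exists_lift (Category.id_comp g) (Category.id_comp f) φ).choose_spec.1

theorem ofHom_injective {A B E : X} {f : B ⟶ E} {g : A ⟶ E} {P : LoosePath 𝕏.Loose A B}
    {ψ ψ' : 𝕏.Globular P (𝕏.hom f g)} (h : ofHom ψ = ofHom ψ') : ψ = ψ' :=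
  (exists_lift (Category.id_comp g) (Category.id_comp f) (ofHom ψ')).unique h rfl

theorem ofHom_id {A B E : X} {f : B ⟶ E} {g : A ⟶ E} :
    ofHom (𝕏.id (𝕏.hom f g)) = 𝕏.homCell f g :=
  𝕏.id_comp (𝕏.homCell f g)

theorem ofHom_gcomp {A B E : X} {f : B ⟶ E} {g : A ⟶ E} {P Q : LoosePath 𝕏.Loose A B}
    (αs : 𝕏.Chain (𝟙 A) (𝟙 B) P Q) (β : 𝕏.Globular Q (𝕏.hom f g)) :
    ofHom (gcomp αs β) = 𝕏.comp (Category.id_comp g) (Category.id_comp f) αs (ofHom β) :=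
  comp_single_comp _ _ _ _ _ _ _ _ αs β _

theorem comp_pair_hcomp {A B C A' B' C' E : X} {f : A ⟶ A'} {f' : A' ⟶ E} {f₂ : A ⟶ E}
    {g : B ⟶ B'} {g' : B' ⟶ E} {g₂ : B ⟶ E} {h : C ⟶ C'} {h' : C' ⟶ E} {h₂ : C ⟶ E}
    {P : LoosePath 𝕏.Loose A B} {P' : LoosePath 𝕏.Loose B C} {S : LoosePath 𝕏.Loose A C}
    {q : 𝕏.Loose A' B'} {q' : 𝕏.Loose B' C'}
    (hS : S = P.append P') (hf : f ≫ f' = f₂) (hg : g ≫ g' = g₂) (hh : h ≫ h' = h₂)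
    (α : 𝕏.Cell f g P q) (α' : 𝕏.Cell g h P' q')
    (β : 𝕏.Cell f' g' (.single q) (𝕏.unit E)) (β' : 𝕏.Cell g' h' (.single q') (𝕏.unit E)) :
    𝕏.comp hf hh (.cons hS α (.single α')) (hcomp rfl β β') =
      hcomp hS (𝕏.comp hf hg (.single α) β) (𝕏.comp hg hh (.single α') β') := by
  unfold hcomp
  rw [comp_pair_comp hS rfl hf hg hh (Category.comp_id f₂) (Category.comp_id h₂)
    (Category.comp_id f') (Category.comp_id h') hf hh]
  congr 1
  subst hS
  rfl

theorem ofHom_pair_homComp {A B C E : X} {f : C ⟶ E} {g : B ⟶ E} {h : A ⟶ E}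
    {P : LoosePath 𝕏.Loose A B} {Q : LoosePath 𝕏.Loose B C}
    (α : 𝕏.Globular P (𝕏.hom g h)) (β : 𝕏.Globular Q (𝕏.hom f g)) :
    ofHom (gcomp (pair α β) (𝕏.homComp f g h)) = hcomp rfl (ofHom α) (ofHom β) := by
  rw [ofHom_gcomp, homComp, ofHom_toHom]
  exact comp_pair_hcomp rfl _ _ _ α β _ _

end VirtualEquipment

namespace VirtualEquipment

variable {X : Type u} [Category.{v} X] {𝕏 : VirtualEquipment.{w, z} X}

theorem unit_unitMul (A : X) :
    gcomp (pair (𝕏.unitCell A) (𝕏.id (𝕏.unit A))) (𝕏.unitMul A) = 𝕏.id (𝕏.unit A) :=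
  (𝕏.unitCell_opcartesian A (.nil A) (.single (𝕏.unit A)) (𝟙 A) (𝟙 A) (𝕏.unit A)
    (𝕏.id (𝕏.unit A))).choose_spec.1

theorem unitMul_unit (A : X) :
    gcomp (pair (𝕏.id (𝕏.unit A)) (𝕏.unitCell A)) (𝕏.unitMul A) = 𝕏.id (𝕏.unit A) := by
  have i : 𝟙 A ≫ 𝟙 A = 𝟙 A := Category.comp_id _
  refine (𝕏.unitCell_opcartesian A (.nil A) (.nil A) (𝟙 A) (𝟙 A) (𝕏.unit A)
    (𝕏.unitCell A)).unique ?_ (𝕏.comp_id _)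
  have h1 := comp_pair_comp (S := .nil A) (P := .nil A) (P' := .nil A) rfl rfl i i i i i i i i i
    (.single (𝕏.unitCell A)) (.nil (𝟙 A)) (𝕏.id (𝕏.unit A)) (𝕏.unitCell A) (𝕏.unitMul A)
  have h2 := comp_pair_comp (S := .nil A) (P := .nil A) (P' := .nil A) rfl rfl i i i i i i i i i
    (.nil (𝟙 A)) (.single (𝕏.unitCell A)) (𝕏.unitCell A) (𝕏.id (𝕏.unit A)) (𝕏.unitMul A)
  have e1 := 𝕏.comp_id (𝕏.unitCell A)
  have e2 : 𝕏.comp i i (.nil (𝟙 A)) (𝕏.unitCell A) = 𝕏.unitCell A := 𝕏.id_comp (𝕏.unitCell A)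
  rw [e1, e2] at h1 h2
  have h3 := unit_unitMul (𝕏 := 𝕏) A
  exact h1.symm.trans (h2.trans ((congrArg (𝕏.comp i i (.single (𝕏.unitCell A))) h3).trans e1))

theorem unitMul_assoc (A : X) :
    gcomp (pair (𝕏.unitMul A) (𝕏.id (𝕏.unit A))) (𝕏.unitMul A) =
      gcomp (pair (𝕏.id (𝕏.unit A)) (𝕏.unitMul A)) (𝕏.unitMul A) := by
  have i : 𝟙 A ≫ 𝟙 A = 𝟙 A := Category.comp_id _
  refine (𝕏.unitCell_opcartesian A (.nil A) (.cons (𝕏.unit A) (.single (𝕏.unit A))) (𝟙 A) (𝟙 A)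
    (𝕏.unit A) (𝕏.unitMul A)).unique ?_ ?_
  · have h1 := comp_pair_comp (P := .single (𝕏.unit A)) (P' := .single (𝕏.unit A)) rfl rfl
      i i i i i i i i i
      (.cons rfl (𝕏.unitCell A) (.single (𝕏.id (𝕏.unit A)))) (.single (𝕏.id (𝕏.unit A)))
      (𝕏.unitMul A) (𝕏.id (𝕏.unit A)) (𝕏.unitMul A)
    have e1 := 𝕏.comp_id (𝕏.id (𝕏.unit A))
    have e2 := unit_unitMul (𝕏 := 𝕏) A
    rw [e1] at h1
    exact h1.symm.trans ((congrArg (fun q ↦ gcomp (pair q (𝕏.id (𝕏.unit A))) (𝕏.unitMul A)) e2).trans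
      (𝕏.id_comp (𝕏.unitMul A)))
  · have h1 := comp_pair_comp (P := .nil A) (P' := .cons (𝕏.unit A) (.single (𝕏.unit A)))
      (S := .cons (𝕏.unit A) (.single (𝕏.unit A))) rfl rfl
      i i i i i i i i i
      (.single (𝕏.unitCell A)) (𝕏.ids (.cons (𝕏.unit A) (.single (𝕏.unit A))))
      (𝕏.id (𝕏.unit A)) (𝕏.unitMul A) (𝕏.unitMul A)
    have h2 := comp_pair_comp (P := .nil A) (P' := .cons (𝕏.unit A) (.single (𝕏.unit A)))
      (S := .cons (𝕏.unit A) (.single (𝕏.unit A))) rfl rfl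
      i i i i i i i i i
      (.nil (𝟙 A)) (.single (𝕏.unitMul A)) (𝕏.unitCell A) (𝕏.id (𝕏.unit A)) (𝕏.unitMul A)
    have e1 := 𝕏.comp_id (𝕏.unitCell A)
    have e2 : 𝕏.comp i i (.nil (𝟙 A)) (𝕏.unitCell A) = 𝕏.unitCell A := 𝕏.id_comp (𝕏.unitCell A)
    have e3 := 𝕏.id_comp (𝕏.unitMul A)
    have e4 := 𝕏.comp_id (𝕏.unitMul A)
    rw [e1, e3] at h1
    rw [e2, e4] at h2
    have h3 := unit_unitMul (𝕏 := 𝕏) A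
    exact h1.symm.trans (h2.trans ((congrArg (𝕏.comp i i (.single (𝕏.unitMul A))) h3).trans e4))

theorem tightId_hcomp {A B E : X} {f : A ⟶ E} {g : B ⟶ E} {P : LoosePath 𝕏.Loose A B}
    (x : 𝕏.Cell f g P (𝕏.unit E)) : hcomp rfl (𝕏.tightId f) x = x := by
  have h := comp_pair_comp (P := .nil A) (P' := P) (S := P) (rfl : _ = (LoosePath.nil A).append P) rfl
    (Category.comp_id f) (Category.comp_id f) (Category.comp_id g) (Category.comp_id f)
    (Category.comp_id g) (Category.comp_id _) (Category.comp_id _) (Category.comp_id f)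
    (Category.comp_id g)
    (.nil f) (.single x) (𝕏.unitCell E) (𝕏.id (𝕏.unit E)) (𝕏.unitMul E)
  have e := 𝕏.comp_id x
  rw [e] at h
  have h3 := unit_unitMul (𝕏 := 𝕏) E
  exact h.trans ((congrArg (𝕏.comp (Category.comp_id f) (Category.comp_id g) (.single x)) h3).trans e)

theorem hcomp_tightId {A B E : X} {f : A ⟶ E} {g : B ⟶ E} {P : LoosePath 𝕏.Loose A B}
    (x : 𝕏.Cell f g P (𝕏.unit E)) : hcomp P.append_nil.symm x (𝕏.tightId g) = x := by
  have h := comp_pair_comp (P := P) (P' := .nil B) P.append_nil.symm rfl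
    (Category.comp_id f) (Category.comp_id g) (Category.comp_id g) (Category.comp_id f)
    (Category.comp_id g) (Category.comp_id _) (Category.comp_id _) (Category.comp_id f)
    (Category.comp_id g)
    (.single x) (.nil g) (𝕏.id (𝕏.unit E)) (𝕏.unitCell E) (𝕏.unitMul E)
  have e := 𝕏.comp_id x
  rw [e] at h
  have c := CellData.Chain.cast_append_nil (CellData.Chain.single x) P.append_nil.symm rfl
  have h3 := unitMul_unit (𝕏 := 𝕏) E
  refine h.trans ?_
  refine (congrArg (fun C ↦ 𝕏.comp (Category.comp_id f) (Category.comp_id g) C _) c).trans ?_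
  exact (congrArg (𝕏.comp (Category.comp_id f) (Category.comp_id g) (.single x)) h3).trans e

theorem hcomp_assoc {A B C D E : X} {f : A ⟶ E} {g : B ⟶ E} {h : C ⟶ E} {k : D ⟶ E}
    {p : 𝕏.Loose A B} {q : 𝕏.Loose B C} {r : 𝕏.Loose C D}
    (x : 𝕏.Cell f g (.single p) (𝕏.unit E)) (y : 𝕏.Cell g h (.single q) (𝕏.unit E))
    (z : 𝕏.Cell h k (.single r) (𝕏.unit E)) :
    hcomp rfl (hcomp rfl x y) z = hcomp rfl x (hcomp rfl y z) := by
  have h1 := comp_pair_comp (P := .cons p (.single q)) (P' := .single r) rfl rfl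
    (Category.comp_id f) (Category.comp_id h) (Category.comp_id k) (Category.comp_id f)
    (Category.comp_id k) (Category.comp_id _) (Category.comp_id _) (Category.comp_id f)
    (Category.comp_id k)
    (.cons rfl x (.single y)) (.single z) (𝕏.unitMul E) (𝕏.id (𝕏.unit E)) (𝕏.unitMul E)
  have h2 := comp_pair_comp (P := .single p) (P' := .cons q (.single r)) rfl rfl
    (Category.comp_id f) (Category.comp_id g) (Category.comp_id k) (Category.comp_id f)
    (Category.comp_id k) (Category.comp_id _) (Category.comp_id _) (Category.comp_id f)
    (Category.comp_id k)
    (.single x) (.cons rfl y (.single z)) (𝕏.id (𝕏.unit E)) (𝕏.unitMul E) (𝕏.unitMul E)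
  have ex := 𝕏.comp_id x
  have ez := 𝕏.comp_id z
  rw [ez] at h1
  rw [ex] at h2
  have h3 := unitMul_assoc (𝕏 := 𝕏) E
  exact h1.trans ((congrArg (𝕏.comp (Category.comp_id f) (Category.comp_id k)
    (.cons rfl x (.cons rfl y (.single z)))) h3).trans h2.symm)

end VirtualEquipment


/-- A monad relative to the tight-cell `j`. The 2-cell `toHom unit : ⇒ E(j, t)` is the
composite of `∩j : ⇒ E(j, j)` with `E(j, η) : E(j, j) ⇒ E(j, t)`. -/
structure RelativeMonad {X : Type u} [Category.{v} X] (𝕏 : VirtualEquipment.{w, z} X) {A E : X}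
    (j : A ⟶ E) where
  t : A ⟶ E
  ext : 𝕏.Globular (.single (𝕏.hom j t)) (𝕏.hom t t)
  unit : 𝕏.TwoCell j t
  ext_unit : vcomp ext (homMap unit t) = 𝕏.id (𝕏.hom j t)
  unit_ext : vcomp (toHom unit) ext = 𝕏.homUnit t
  ext_ext : gcomp (pair ext ext) (𝕏.homComp t t t) =
    vcomp (gcomp (pair ext (𝕏.id (𝕏.hom j t))) (𝕏.homComp j t t)) ext

/-- An opalgebra with codomain `B` for a relative monad `T`. -/
structure Opalgebra {X : Type u} [Category.{v} X] {𝕏 : VirtualEquipment.{w, z} X} {A E : X}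
    {j : A ⟶ E} (T : RelativeMonad 𝕏 j) (B : X) where
  a : A ⟶ B
  opext : 𝕏.Globular (.single (𝕏.hom j T.t)) (𝕏.hom a a)
  unit_opext : vcomp (toHom T.unit) opext = 𝕏.homUnit a
  opext_opext : gcomp (pair opext opext) (𝕏.homComp a a a) =
    vcomp (gcomp (pair T.ext (𝕏.id (𝕏.hom j T.t))) (𝕏.homComp j T.t T.t)) opext

namespace Opalgebra

variable {X : Type u} [Category.{v} X] {𝕏 : VirtualEquipment.{w, z} X} {A E : X} {j : A ⟶ E}
  {T : RelativeMonad 𝕏 j}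

/-- The right action `ρ : E(j, t), B(1, a) ⇒ B(1, a)` corresponding to the opextension operator of
an opalgebra. -/
noncomputable def action {B : X} (x : Opalgebra T B) :
    𝕏.Globular (.cons (𝕏.hom j T.t) (.single (𝕏.hom (𝟙 B) x.a))) (𝕏.hom (𝟙 B) x.a) :=
  gcomp (pair x.opext (𝕏.id (𝕏.hom (𝟙 B) x.a))) (𝕏.homComp (𝟙 B) x.a x.a)

/-- `IsGradedMorphism x x' α` says that the 2-cell `α : B(1, a), pₙ, …, p₁ ⇒ B'(1, a')` (the chain
being read from left to right) is a `(p₁, …, pₙ)`-graded opalgebra morphism from `x` to `x'`. -/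
def IsGradedMorphism {B B' : X} (x : Opalgebra T B) (x' : Opalgebra T B')
    {p : LoosePath 𝕏.Loose B B'}
    (α : 𝕏.Globular (.cons (𝕏.hom (𝟙 B) x.a) p) (𝕏.hom (𝟙 B') x'.a)) : Prop :=
  gcomp (.cons rfl x.action (𝕏.ids p)) α =
    gcomp (.cons rfl (𝕏.id (𝕏.hom j T.t)) (.single α)) x'.action

/-- A tight-cell `c` out of the codomain of the opalgebra `k` carries `k` to the opalgebra `x`. -/
structure Mediates {K B : X} (k : Opalgebra T K) (x : Opalgebra T B) (c : K ⟶ B) : Prop where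
  tight : k.a ≫ c = x.a
  opext : mapHom k.opext c tight tight = x.opext

/-- An opalgebra `k` with codomain `K` is an opalgebra object for the relative monad. -/
structure IsOpalgebraObject {K : X} (k : Opalgebra T K) : Prop where
  existsUnique_tight : ∀ ⦃B : X⦄ (x : Opalgebra T B), ∃! c : K ⟶ B, k.Mediates x c
  existsUnique_cell : ∀ ⦃B B' : X⦄ (x : Opalgebra T B) (x' : Opalgebra T B') (c : K ⟶ B)
    (c' : K ⟶ B') (hc : k.Mediates x c) (hc' : k.Mediates x' c') (p : LoosePath 𝕏.Loose B B')
    (α : 𝕏.Globular (.cons (𝕏.hom (𝟙 B) x.a) p) (𝕏.hom (𝟙 B') x'.a)),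
    x.IsGradedMorphism x' α →
      ∃! β : 𝕏.Globular (.cons (𝕏.hom (𝟙 B) c) p) (𝕏.hom (𝟙 B') c'),
        restrictAlong k.a hc.tight hc'.tight β = α

end Opalgebra

/-- The relative monad `T` admits an opalgebra object. -/
def RelativeMonad.AdmitsOpalgebraObject {X : Type u} [Category.{v} X]
    {𝕏 : VirtualEquipment.{w, z} X} {A E : X} {j : A ⟶ E} (T : RelativeMonad 𝕏 j) : Prop :=
  ∃ (K : X) (k : Opalgebra T K), k.IsOpalgebraObject

namespace RelativeMonad

variable {X : Type u} [Category.{v} X] {𝕏 : VirtualEquipment.{w, z} X}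

variable (𝕏) in
/-- The trivial monad relative to `j`. -/
noncomputable def trivial {A E : X} (j : A ⟶ E) : RelativeMonad 𝕏 j where
  t := j
  ext := 𝕏.id (𝕏.hom j j)
  unit := 𝕏.tightId j
  ext_unit := by
    refine (𝕏.id_comp _).trans (ofHom_injective ?_)
    rw [homMap, ofHom_toHom, ofHom_id]
    exact hcomp_tightId _
  unit_ext := 𝕏.comp_id _
  ext_ext := (𝕏.comp_id _).symm

variable {A E : X} {j : A ⟶ E}

/-- The loose-monad `E(j, T)` induced by a relative monad `T`. -/
noncomputable def looseMonad (T : RelativeMonad 𝕏 j) : LooseMonad 𝕏.toVirtualDoubleCategory A where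
  t := 𝕏.hom j T.t
  mul := gcomp (pair T.ext (𝕏.id (𝕏.hom j T.t))) (𝕏.homComp j T.t T.t)
  unit := toHom T.unit
  mul_assoc := by
    have hm : ofHom (gcomp (pair T.ext (𝕏.id (𝕏.hom j T.t))) (𝕏.homComp j T.t T.t)) =
        hcomp rfl (ofHom T.ext) (𝕏.homCell j T.t) := by
      rw [ofHom_pair_homComp, ofHom_id]
    have he : ofHom (gcomp (pair T.ext T.ext) (𝕏.homComp T.t T.t T.t)) =
        hcomp rfl (ofHom T.ext) (ofHom T.ext) := ofHom_pair_homComp _ _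
    rw [T.ext_ext, ofHom_gcomp] at he
    have hd : 𝕏.comp (Category.id_comp T.t) (Category.id_comp T.t)
        (.single (𝕏.id (𝕏.hom j T.t))) (ofHom T.ext) = ofHom T.ext := 𝕏.id_comp _
    apply ofHom_injective
    refine (ofHom_gcomp _ _).trans (Eq.trans ?_ (ofHom_gcomp _ _).symm)
    rw [hm,
      comp_pair_hcomp rfl _ (Category.id_comp T.t), comp_pair_hcomp rfl _ (Category.id_comp T.t)]
    refine (congrArg₂ (hcomp rfl) he (𝕏.id_comp (𝕏.homCell j T.t))).trans ?_
    exact (hcomp_assoc _ _ _).trans (congrArg₂ (hcomp rfl) hd hm).symm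
  unit_mul := by
    apply ofHom_injective
    rw [ofHom_gcomp, ofHom_pair_homComp, ofHom_id]
    rw [comp_pair_hcomp rfl _ (Category.id_comp T.t)]
    have h : 𝕏.comp (Category.id_comp T.t) (Category.id_comp T.t)
        (.single (toHom T.unit)) (ofHom T.ext) = 𝕏.tightId T.t := by
      rw [← ofHom_gcomp]
      exact (congrArg ofHom T.unit_ext).trans (ofHom_toHom _)
    exact (congrArg₂ (hcomp rfl) h (𝕏.id_comp (𝕏.homCell j T.t))).trans (tightId_hcomp _)
  mul_unit := by
    apply ofHom_injective
    rw [ofHom_gcomp, ofHom_pair_homComp, ofHom_id]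
    rw [comp_pair_hcomp rfl _ (Category.id_comp T.t)]
    have hd : 𝕏.comp (Category.id_comp T.t) (Category.id_comp T.t)
        (.single (𝕏.id (𝕏.hom j T.t))) (ofHom T.ext) = ofHom T.ext := 𝕏.id_comp _
    have h := congrArg ofHom T.ext_unit
    rw [ofHom_gcomp, homMap, ofHom_toHom, ofHom_id] at h
    refine (congrArg₂ (hcomp rfl) hd (ofHom_toHom T.unit)).trans (Eq.trans ?_ h)
    refine Eq.trans ?_ (comp_pair_comp (P := .single (𝕏.hom j T.t)) (P' := .nil A) rfl rfl
      (Category.id_comp T.t) (Category.id_comp T.t) (Category.id_comp j) (Category.comp_id _)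
      (Category.comp_id _) (Category.comp_id _) (Category.comp_id _) (Category.id_comp _)
      (Category.id_comp _) (.single T.ext) (.nil (𝟙 A)) (𝕏.homCell T.t T.t) T.unit (𝕏.unitMul E))
    exact congrArg (hcomp rfl (ofHom T.ext)) (𝕏.id_comp T.unit).symm

end RelativeMonad

/-- The loose-monad `C(ℓ, ℓ)` induced by a tight-cell `ℓ : A ⟶ C`: its multiplication is
`C(ℓ, 1), ∪ℓ, C(1, ℓ)` and its unit is `∩ℓ`, where `∩ℓ` and `∪ℓ` are the unit and the counit of
the loose-adjunction `C(1, ℓ) ⊣ C(ℓ, 1)`. -/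
noncomputable def VirtualEquipment.looseMonad {X : Type u} [Category.{v} X]
    (𝕏 : VirtualEquipment.{w, z} X) {A C : X} (l : A ⟶ C) :
    LooseMonad 𝕏.toVirtualDoubleCategory A where
  t := 𝕏.hom l l
  mul := 𝕏.homComp l l l
  unit := 𝕏.homUnit l
  mul_assoc := by
    have hm : ofHom (𝕏.homComp l l l) = hcomp rfl (𝕏.homCell l l) (𝕏.homCell l l) :=
      ofHom_toHom _
    apply ofHom_injective
    rw [ofHom_pair_homComp, ofHom_pair_homComp, ofHom_id, hm]
    exact hcomp_assoc _ _ _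
  unit_mul := by
    apply ofHom_injective
    rw [ofHom_pair_homComp, ofHom_id]
    exact (congrArg (fun q ↦ hcomp rfl q (𝕏.homCell l l)) (ofHom_toHom (𝕏.tightId l))).trans
      (tightId_hcomp _)
  mul_unit := by
    apply ofHom_injective
    rw [ofHom_pair_homComp, ofHom_id]
    exact (congrArg (hcomp rfl (𝕏.homCell l l)) (ofHom_toHom (𝕏.tightId l))).trans
      (hcomp_tightId _)

namespace LooseMonad

variable {X : Type u} [Category.{v} X] {𝕏 : VirtualDoubleCategory.{w, z} X} {A : X}

/-- A morphism of loose-monads on `A`. -/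
structure IsHom (M N : LooseMonad 𝕏 A) (τ : 𝕏.Globular (.single M.t) N.t) : Prop where
  unit : vcomp M.unit τ = N.unit
  mul : vcomp M.mul τ = gcomp (pair τ τ) N.mul

/-- Two loose-monads on `A` are isomorphic. -/
def Isomorphic (M N : LooseMonad 𝕏 A) : Prop :=
  ∃ (τ : 𝕏.Globular (.single M.t) N.t) (σ : 𝕏.Globular (.single N.t) M.t),
    M.IsHom N τ ∧ N.IsHom M σ ∧ vcomp τ σ = 𝕏.id M.t ∧ vcomp σ τ = 𝕏.id N.t

end LooseMonad

/-- A loose-monad on `A` is induced by the tight-cell `l : A ⟶ C` if it is, up to isomorphism,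
the loose-monad `C(l, l)`. -/
def LooseMonad.IsInducedBy {X : Type u} [Category.{v} X] {𝕏 : VirtualEquipment.{w, z} X} {A C : X}
    (M : LooseMonad 𝕏.toVirtualDoubleCategory A) (l : A ⟶ C) : Prop :=
  M.Isomorphic (𝕏.looseMonad l)

/-- An adjunction relative to `j` with left adjoint `l` and right adjoint `r`. -/
structure RelativeAdjunction {X : Type u} [Category.{v} X] (𝕏 : VirtualEquipment.{w, z} X)
    {A C E : X} (j : A ⟶ E) (l : A ⟶ C) (r : C ⟶ E) where
  sharp : 𝕏.Globular (.single (𝕏.hom l (𝟙 C))) (𝕏.hom j r)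
  flat : 𝕏.Globular (.single (𝕏.hom j r)) (𝕏.hom l (𝟙 C))
  sharp_flat : vcomp sharp flat = 𝕏.id (𝕏.hom l (𝟙 C))
  flat_sharp : vcomp flat sharp = 𝕏.id (𝕏.hom j r)

namespace RelativeAdjunction

variable {X : Type u} [Category.{v} X] {𝕏 : VirtualEquipment.{w, z} X} {A C E : X} {j : A ⟶ E}
  {l : A ⟶ C} {r : C ⟶ E}

/-- The unit `j ⇒ l ≫ r` of a relative adjunction, which corresponds to the composite of
`∩l : ⇒ C(l, l)` with the restriction `C(l, l) ⇒ E(j, r l)` of `♯` along `l`. -/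
noncomputable def unit (adj : RelativeAdjunction 𝕏 j l r) {t : A ⟶ E} (ht : l ≫ r = t) :
    𝕏.TwoCell j t :=
  ofHom (vcomp (𝕏.homUnit l) (restrictAlong l (Category.comp_id l) ht adj.sharp))

/-- The extension operator of the relative monad with underlying tight-cell `l ≫ r` that is
induced by a relative adjunction: the restriction `E(j, r l) ⇒ C(l, l)` of `♭` along `l`, mapped
by `r`. -/
noncomputable def ext (adj : RelativeAdjunction 𝕏 j l r) {t : A ⟶ E} (ht : l ≫ r = t) :
    𝕏.Globular (.single (𝕏.hom j t)) (𝕏.hom t t) :=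
  mapHom (restrictAlong l ht (Category.comp_id l) adj.flat) r ht ht

/-- A relative adjunction is a resolution of `T` if `T` equals the relative monad induced by it. -/
structure IsResolution (adj : RelativeAdjunction 𝕏 j l r) (T : RelativeMonad 𝕏 j) : Prop where
  tight : l ≫ r = T.t
  unit : adj.unit tight = T.unit
  ext : adj.ext tight = T.ext

end RelativeAdjunction

/-! A `T`-opalgebra is a tight-cell `a` together with a morphism of loose-monads `E(j, T) ⇒ B(a,
a)`, so the notion depends on `j` and `T` only through `E(j, T)`. An isomorphism between the
loose-monads of two relative monads, possibly with different roots, therefore gives by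
precomposition a bijection between their opalgebras that keeps the underlying tight-cells
(`pullback`, `pullback_pullback`). Mediating tight-cells and graded morphisms are preserved as well
(`Mediates.pullback`, `IsGradedMorphism.pullback`), so both clauses of the universal property carry
over (`IsOpalgebraObject.pullback`). Since the trivial `ℓ`-monad has loose-monad `C(ℓ, ℓ)`
(`looseMonad_trivial`), being induced by `ℓ` is exactly such an isomorphism. The comparison of
opalgebra objects then reduces to their uniqueness for a single relative monad (`exists_iso`).

For a resolution, the isomorphism `E(j, rℓ) ⇒ C(ℓ, ℓ)` is the restriction of `♭` along `ℓ`, with the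
restriction of `♯` as inverse. The unit of `T` is by definition `∩ℓ` followed by the latter, so
units agree. For multiplications, the extension operator is `♭` followed by `r`, so multiplying in
`E(j, T)` amounts to applying `♭` to one factor and letting the result act on `E(j, r)` through the
action of `C(1, 1)` induced by `r`. Opcartesianness of the loose-identity forces `♭` to respect this
action (`unitAction_comp`), and the product becomes composition in `C(ℓ, ℓ)` (`mul_restrictAlong`).
-/

/-! ### Rows of identities and associativity of whiskered composites -/

namespace CellOperations

variable {X : Type u} [Category.{v} X] (D : CellOperations.{w, z} X)

/-- The stack of two rows of identity 2-cells on a chain of loose-cells. -/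
def idsStack : {A B : X} → (P : LoosePath D.Loose A B) →
    D.Stack (𝟙 A) (𝟙 A) (𝟙 B) (𝟙 B) P P P
  | _, _, .nil A => .nil (𝟙 A) (𝟙 A)
  | _, _, .cons p P => .cons rfl rfl (.single (D.id p)) (D.id p) (idsStack P)

theorem top_idsStack : {A B : X} → (P : LoosePath D.Loose A B) → (D.idsStack P).top = D.ids P
  | _, _, .nil _ => rfl
  | _, _, .cons p P => congrArg (CellData.Chain.cons rfl (D.id p)) (top_idsStack P)

theorem bottom_idsStack : {A B : X} → (P : LoosePath D.Loose A B) →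
    (D.idsStack P).bottom = D.ids P
  | _, _, .nil _ => rfl
  | _, _, .cons p P => congrArg (CellData.Chain.cons rfl (D.id p)) (bottom_idsStack P)

variable {D}

/-- Legs such as `f ≫ 𝟙 _` and `f` are only propositionally equal, so composites coming from `assoc`
are compared by heterogeneous equality, with the equations of legs supplied separately. -/
theorem comp_heq {A B A' B' A'' B'' : X} {f₁ f₂ : A ⟶ A'} {f₁' f₂' : A' ⟶ A''}
    {f₁'' f₂'' : A ⟶ A''} {g₁ g₂ : B ⟶ B'} {g₁' g₂' : B' ⟶ B''} {g₁'' g₂'' : B ⟶ B''}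
    {P : LoosePath D.Loose A B} {Q : LoosePath D.Loose A' B'} {r : D.Loose A'' B''}
    (hf₁ : f₁ ≫ f₁' = f₁'') (hg₁ : g₁ ≫ g₁' = g₁'') (hf₂ : f₂ ≫ f₂' = f₂'')
    (hg₂ : g₂ ≫ g₂' = g₂'') (hf : f₁ = f₂) (hg : g₁ = g₂) (hf' : f₁' = f₂') (hg' : g₁' = g₂')
    {αs₁ : D.Chain f₁ g₁ P Q} {αs₂ : D.Chain f₂ g₂ P Q} {β₁ : D.Cell f₁' g₁' Q r}
    {β₂ : D.Cell f₂' g₂' Q r} (hαs : HEq αs₁ αs₂) (hβ : HEq β₁ β₂) :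
    HEq (D.comp hf₁ hg₁ αs₁ β₁) (D.comp hf₂ hg₂ αs₂ β₂) := by
  subst hf₁ hg₁ hf₂ hg₂ hf hg hf' hg'
  rw [eq_of_heq hαs, eq_of_heq hβ]

theorem cons_heq {A B C A' B' C' : X} {f₁ f₂ : A ⟶ A'} {g₁ g₂ : B ⟶ B'} {h₁ h₂ : C ⟶ C'}
    {P : LoosePath D.Loose A B} {Q : LoosePath D.Loose B C} {S : LoosePath D.Loose A C}
    {q : D.Loose A' B'} {R : LoosePath D.Loose B' C'} (hS : S = P.append Q) (hf : f₁ = f₂)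
    (hg : g₁ = g₂) (hh : h₁ = h₂) {α₁ : D.Cell f₁ g₁ P q} {α₂ : D.Cell f₂ g₂ P q}
    {αs₁ : D.Chain g₁ h₁ Q R} {αs₂ : D.Chain g₂ h₂ Q R} (hα : HEq α₁ α₂) (hαs : HEq αs₁ αs₂) :
    HEq (CellData.Chain.cons hS α₁ αs₁) (CellData.Chain.cons hS α₂ αs₂) := by
  subst hf hg hh
  obtain rfl := eq_of_heq hα
  obtain rfl := eq_of_heq hαs
  rfl

end CellOperations

namespace VirtualDoubleCategory

variable {X : Type u} [Category.{v} X] {𝕏 : VirtualDoubleCategory.{w, z} X}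

/-- The two sides have legs `𝟙 ≫ 𝟙` and `𝟙`; apart from that, this is idempotence of identity
2-cells, applied one loose-cell at a time. -/
theorem compStack_idsStack_heq : {A B : X} → (P : LoosePath 𝕏.Loose A B) →
    HEq (𝕏.compStack (𝕏.idsStack P)) (𝕏.ids P)
  | _, _, .nil A => by
    change HEq (CellData.Chain.nil (𝟙 A ≫ 𝟙 A)) (CellData.Chain.nil (𝟙 A))
    rw [Category.comp_id]
  | _, _, .cons p P =>
    CellOperations.cons_heq rfl (Category.comp_id _) (Category.comp_id _) (Category.comp_id _)
      ((CellOperations.comp_heq _ _ _ _ rfl rfl rfl rfl HEq.rfl HEq.rfl).trans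
        (heq_of_eq (𝕏.comp_id (𝕏.id p))))
      (compStack_idsStack_heq P)

/-- Associativity for a globular composite whose upper 2-cell is itself a composite, juxtaposed with
a row of identities on the right. -/
theorem gcomp_cons_gcomp_ids {A B C : X} {P Q : LoosePath 𝕏.Loose A B} {r : 𝕏.Loose A B}
    {p : LoosePath 𝕏.Loose B C} {s : 𝕏.Loose A C} (αs : 𝕏.Chain (𝟙 A) (𝟙 B) P Q)
    (β : 𝕏.Globular Q r) (γ : 𝕏.Globular (.cons r p) s) :
    gcomp (.cons rfl (gcomp αs β) (𝕏.ids p)) γ =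
      gcomp (αs.append (𝕏.ids p)) (gcomp (.cons rfl β (𝕏.ids p)) γ) := by
  -- The identities on `p` are doubled, so that the right-hand part of the stack also has two
  -- layers.
  have h := 𝕏.assoc (.cons rfl rfl αs β (𝕏.idsStack p)) γ
  simp only [CellData.Stack.top, CellData.Stack.bottom, CellOperations.top_idsStack,
    CellOperations.bottom_idsStack] at h
  have i : ∀ Y : X, 𝟙 Y ≫ 𝟙 Y = 𝟙 Y := fun Y ↦ Category.comp_id (𝟙 Y)
  refine eq_of_heq (HEq.trans ?_ ((heq_of_eq h).trans ?_))
  · exact CellOperations.comp_heq _ _ _ _ (i _).symm (i _).symm rfl rfl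
      (CellOperations.cons_heq rfl (i _).symm (i _).symm (i _).symm
        (CellOperations.comp_heq _ _ _ _ rfl rfl rfl rfl HEq.rfl HEq.rfl)
        (compStack_idsStack_heq p).symm) HEq.rfl
  · exact CellOperations.comp_heq _ _ _ _ rfl rfl (i _) (i _) HEq.rfl
      (CellOperations.comp_heq _ _ _ _ rfl rfl rfl rfl HEq.rfl HEq.rfl)

end VirtualDoubleCategory
-- Inverses of morphisms of loose-monads
namespace LooseMonad

variable {X : Type u} [Category.{v} X] {𝕏 : VirtualDoubleCategory.{w, z} X} {A : X}

/-- The inverse of an invertible morphism of loose-monads is a morphism of loose-monads. -/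
theorem IsHom.inverse {M N : LooseMonad 𝕏 A} {τ : 𝕏.Globular (.single M.t) N.t}
    {σ : 𝕏.Globular (.single N.t) M.t} (hτ : M.IsHom N τ) (hτσ : vcomp τ σ = 𝕏.id M.t)
    (hστ : vcomp σ τ = 𝕏.id N.t) : N.IsHom M σ := by
  have i : 𝟙 A ≫ 𝟙 A = 𝟙 A := Category.comp_id _
  constructor
  · have h := comp_single_comp i i i i i i i i (.single M.unit) τ σ
    exact (congrArg (fun q ↦ vcomp q σ) hτ.unit).symm.trans
      (h.trans ((congrArg (vcomp M.unit) hτσ).trans (𝕏.comp_id _)))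
  · have h₁ := comp_single_comp i i i i i i i i (.single M.mul) τ σ
    have h₂ := comp_single_comp i i i i i i i i (pair τ τ) N.mul σ
    have h₃ := comp_pair_comp rfl rfl i i i i i i i i i
      (.single σ) (.single σ) τ τ (vcomp N.mul σ)
    have h₄ : vcomp (vcomp M.mul τ) σ = M.mul :=
      h₁.trans ((congrArg (vcomp M.mul) hτσ).trans (𝕏.comp_id _))
    rw [hτ.mul] at h₄
    -- Multiplicativity of `τ` turns `(τ, τ)` followed by `N.mul` and `σ` into `M.mul`; precomposing
    -- with `(σ, σ)` cancels `(τ, τ)`.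
    have h₅ : gcomp (pair σ σ) (gcomp (pair τ τ) (vcomp N.mul σ)) = vcomp N.mul σ :=
      h₃.symm.trans ((congrArg (fun q ↦ gcomp (pair q q) (vcomp N.mul σ)) hστ).trans
        (𝕏.id_comp _))
    exact h₅.symm.trans (congrArg (gcomp (pair σ σ)) (h₂.symm.trans h₄))

end LooseMonad

/-! ### Functoriality of restriction along tight-cells and of postcomposition with tight-cells -/

namespace VirtualEquipment

variable {X : Type u} [Category.{v} X] {𝕏 : VirtualEquipment.{w, z} X}

theorem lift_homCell {A B E Y Z : X} {f : B ⟶ E} {g : A ⟶ E} {R : LoosePath 𝕏.Loose Y Z}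
    {g' : Y ⟶ A} {f' : Z ⟶ B} {g'' : Y ⟶ E} {f'' : Z ⟶ E} (hg : g' ≫ g = g'') (hf : f' ≫ f = f'')
    (φ : 𝕏.Cell g'' f'' R (𝕏.unit E)) :
    𝕏.comp hg hf (.single (lift hg hf φ)) (𝕏.homCell f g) = φ :=
  (exists_lift hg hf φ).choose_spec.1

theorem homCell_injective {A B E Y Z : X} {f : B ⟶ E} {g : A ⟶ E} {R : LoosePath 𝕏.Loose Y Z}
    {g' : Y ⟶ A} {f' : Z ⟶ B} {g'' : Y ⟶ E} {f'' : Z ⟶ E} (hg : g' ≫ g = g'') (hf : f' ≫ f = f'')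
    {ψ ψ' : 𝕏.Cell g' f' R (𝕏.hom f g)}
    (h : 𝕏.comp hg hf (.single ψ) (𝕏.homCell f g) =
      𝕏.comp hg hf (.single ψ') (𝕏.homCell f g)) : ψ = ψ' :=
  (exists_lift hg hf _).unique h rfl

theorem ofHom_mapHom {A B C D : X} {f : B ⟶ C} {g : A ⟶ C} {P : LoosePath 𝕏.Loose A B}
    (φ : 𝕏.Globular P (𝕏.hom f g)) (k : C ⟶ D) {f' : B ⟶ D} {g' : A ⟶ D} (hf : f ≫ k = f')
    (hg : g ≫ k = g') :
    ofHom (mapHom φ k hf hg) = 𝕏.comp hg hf (.single (ofHom φ)) (𝕏.unitMap k) :=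
  ofHom_toHom _

/-- The 2-cell `E(f, g k) ⇒ E(f, g)` is natural with respect to 2-cells between restrictions. -/
theorem restrictAlong_homRestr {A B C E E' C' : X} (k : A ⟶ B) {f : C ⟶ E} {g : B ⟶ E}
    {f' : C' ⟶ E'} {g' : B ⟶ E'} {x : A ⟶ E} {x' : A ⟶ E'} (hx : k ≫ g = x) (hx' : k ≫ g' = x')
    {p : LoosePath 𝕏.Loose C C'} (β : 𝕏.Globular (.cons (𝕏.hom f g) p) (𝕏.hom f' g')) :
    𝕏.comp (Category.id_comp k) (Category.id_comp (𝟙 C')) (.single (restrictAlong k hx hx' β))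
        (homRestr k g' f' hx') =
      𝕏.comp (Category.comp_id k) (Category.id_comp (𝟙 C'))
        (.cons rfl (homRestr k g f hx) (𝕏.ids p)) β := by
  apply homCell_injective hx' (Category.id_comp f')
  rw [comp_single_comp (Category.id_comp k) (Category.id_comp (𝟙 C')) hx' (Category.id_comp f')
    hx' (Category.id_comp f') (Category.id_comp x') (Category.id_comp f')]
  exact (congrArg (𝕏.comp (Category.id_comp x') (Category.id_comp f') _)
    (lift_homCell hx' (Category.id_comp f') _)).trans (ofHom_toHom _)

theorem ofHom_restrictAlong {A B C E E' C' : X} (k : A ⟶ B) {f : C ⟶ E} {g : B ⟶ E}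
    {f' : C' ⟶ E'} {g' : B ⟶ E'} {x : A ⟶ E} {x' : A ⟶ E'} (hx : k ≫ g = x) (hx' : k ≫ g' = x')
    {p : LoosePath 𝕏.Loose C C'} (β : 𝕏.Globular (.cons (𝕏.hom f g) p) (𝕏.hom f' g')) :
    ofHom (restrictAlong k hx hx' β) =
      𝕏.comp hx' (Category.id_comp f') (.cons rfl (homRestr k g f hx) (𝕏.ids p)) (ofHom β) :=
  (ofHom_toHom _).trans (comp_single_comp _ _ _ _ _ _ _ _ _ _ _)

theorem restrictAlong_id {A B C E : X} (k : A ⟶ B) {f : C ⟶ E} {g : B ⟶ E} {x : A ⟶ E}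
    (hx : k ≫ g = x) : restrictAlong k hx hx (𝕏.id (𝕏.hom f g)) = 𝕏.id (𝕏.hom f x) := by
  apply ofHom_injective
  rw [ofHom_restrictAlong, ofHom_id, ofHom_id]
  exact lift_homCell hx (Category.id_comp f) _

/-- Naturality of `homRestr` lets it slide past `β`. Together with `restrictAlong_id` this makes the
restrictions of `♯` and `♭` mutually inverse. -/
theorem restrictAlong_vcomp {A B C E E' E'' : X} (k : A ⟶ B) {f : C ⟶ E} {g : B ⟶ E}
    {f' : C ⟶ E'} {g' : B ⟶ E'} {f'' : C ⟶ E''} {g'' : B ⟶ E''} {x : A ⟶ E} {x' : A ⟶ E'}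
    {x'' : A ⟶ E''} (hx : k ≫ g = x) (hx' : k ≫ g' = x') (hx'' : k ≫ g'' = x'')
    (β : 𝕏.Globular (.single (𝕏.hom f g)) (𝕏.hom f' g'))
    (β' : 𝕏.Globular (.single (𝕏.hom f' g')) (𝕏.hom f'' g'')) :
    restrictAlong k hx hx'' (vcomp β β') =
      vcomp (restrictAlong k hx hx' β) (restrictAlong k hx' hx'' β') := by
  apply ofHom_injective
  rw [ofHom_restrictAlong, ofHom_gcomp, ofHom_gcomp, ofHom_restrictAlong]
  have h₁ := comp_single_comp (Category.comp_id k) (Category.id_comp (𝟙 C)) hx''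
    (Category.id_comp f'') (Category.id_comp g'') (Category.id_comp f'') hx''
    (Category.id_comp f'') (.single (homRestr k g f hx)) β (ofHom β')
  have h₂ := comp_single_comp (Category.id_comp k) (Category.id_comp (𝟙 C)) hx''
    (Category.id_comp f'') hx'' (Category.id_comp f'') (Category.id_comp x'')
    (Category.id_comp f'') (.single (restrictAlong k hx hx' β)) (homRestr k g' f' hx') (ofHom β')
  have h₃ := restrictAlong_homRestr k hx hx' β
  exact h₁.symm.trans ((congrArg (fun q ↦ 𝕏.comp hx'' (Category.id_comp f'') (.single q)
    (ofHom β')) h₃).symm.trans h₂)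

theorem mapHom_gcomp {A B C D : X} {f : B ⟶ C} {g : A ⟶ C} {P Q : LoosePath 𝕏.Loose A B}
    (αs : 𝕏.Chain (𝟙 A) (𝟙 B) P Q) (φ : 𝕏.Globular Q (𝕏.hom f g)) (k : C ⟶ D) {f' : B ⟶ D}
    {g' : A ⟶ D} (hf : f ≫ k = f') (hg : g ≫ k = g') :
    mapHom (gcomp αs φ) k hf hg = gcomp αs (mapHom φ k hf hg) := by
  apply ofHom_injective
  rw [ofHom_mapHom, ofHom_gcomp, ofHom_gcomp, ofHom_mapHom]
  exact comp_single_comp _ _ _ _ _ _ _ _ _ _ _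

theorem unitCell_unitMap {A B : X} (f : A ⟶ B) :
    𝕏.comp (Category.id_comp f) (Category.id_comp f) (.single (𝕏.unitCell A)) (𝕏.unitMap f) =
      𝕏.tightId f :=
  (𝕏.unitCell_opcartesian A (.nil A) (.nil A) f f (𝕏.unit B) (𝕏.tightId f)).choose_spec.1

/-- The uniqueness half of opcartesianness, with the loose-identity in first position: equations of
2-cells out of `A(1, 1), P` may be checked after inserting the unit. -/
theorem unitCell_injective {A B Y' Z' : X}
    {P : LoosePath 𝕏.Loose A B} {f : A ⟶ Y'} {g : B ⟶ Z'} {s : 𝕏.Loose Y' Z'}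
    {ψ ψ' : 𝕏.Cell f g (.cons (𝕏.unit A) P) s}
    (h : 𝕏.comp (Category.id_comp f) (Category.id_comp g) (.cons rfl (𝕏.unitCell A) (𝕏.ids P)) ψ =
      𝕏.comp (Category.id_comp f) (Category.id_comp g) (.cons rfl (𝕏.unitCell A) (𝕏.ids P)) ψ') :
    ψ = ψ' :=
  (𝕏.unitCell_opcartesian A (.nil A) P f g s _).unique h rfl

theorem unitMap_id (A : X) : 𝕏.unitMap (𝟙 A) = 𝕏.id (𝕏.unit A) := by
  apply unitCell_injective
  refine (unitCell_unitMap (𝟙 A)).trans ?_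
  exact (𝕏.id_comp (𝕏.unitCell A)).trans (𝕏.comp_id (𝕏.unitCell A)).symm

/-- Both sides are the unit of `C` precomposed with tight-cells: with `f` and then `g` on the left,
with their composite on the right. -/
theorem tightId_unitMap {A B C : X} (f : A ⟶ B) (g : B ⟶ C) {h : A ⟶ C} (hh : f ≫ g = h) :
    𝕏.comp hh hh (.single (𝕏.tightId f)) (𝕏.unitMap g) = 𝕏.tightId h := by
  have h₁ := comp_single_comp (Category.comp_id f) (Category.comp_id f) hh hh
    (Category.id_comp g) (Category.id_comp g) hh hh (.nil f) (𝕏.unitCell B) (𝕏.unitMap g)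
  rw [unitCell_unitMap] at h₁
  refine h₁.trans ?_
  -- Associativity for the empty stack says that precomposing a nullary 2-cell with `f ≫ g` is
  -- precomposing with `g` and then with `f`.
  have h₂ := 𝕏.assoc (.nil f g) (𝕏.unitCell C)
  subst hh
  refine eq_of_heq (HEq.trans ?_ ((heq_of_eq h₂.symm).trans ?_))
  · exact CellOperations.comp_heq _ _ _ _ rfl rfl (Category.comp_id g).symm
      (Category.comp_id g).symm HEq.rfl
      (CellOperations.comp_heq _ _ _ _ rfl rfl rfl rfl HEq.rfl HEq.rfl)
  · exact CellOperations.comp_heq _ _ _ _ rfl rfl rfl rfl HEq.rfl HEq.rfl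

theorem unitMap_comp {A B C : X} (f : A ⟶ B) (g : B ⟶ C) {h : A ⟶ C} (hh : f ≫ g = h) :
    𝕏.unitMap h = 𝕏.comp hh hh (.single (𝕏.unitMap f)) (𝕏.unitMap g) := by
  apply unitCell_injective
  refine (unitCell_unitMap h).trans (Eq.trans ?_ (comp_single_comp (Category.id_comp f)
    (Category.id_comp f) hh hh hh hh (Category.id_comp h) (Category.id_comp h)
    (.single (𝕏.unitCell A)) (𝕏.unitMap f) (𝕏.unitMap g)))
  rw [unitCell_unitMap, tightId_unitMap]

theorem mapHom_id {A B C : X} {f : B ⟶ C} {g : A ⟶ C} {P : LoosePath 𝕏.Loose A B}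
    (φ : 𝕏.Globular P (𝕏.hom f g)) :
    mapHom φ (𝟙 C) (Category.comp_id f) (Category.comp_id g) = φ := by
  apply ofHom_injective
  rw [ofHom_mapHom, unitMap_id, 𝕏.comp_id]

/-- With `mapHom_id`, this is what lets mediating tight-cells be composed and makes identities
mediate. -/
theorem mapHom_mapHom {A B C D D' : X} {f : B ⟶ C} {g : A ⟶ C} {P : LoosePath 𝕏.Loose A B}
    (φ : 𝕏.Globular P (𝕏.hom f g)) (k : C ⟶ D) (k' : D ⟶ D') {f' : B ⟶ D} {g' : A ⟶ D}
    {f'' : B ⟶ D'} {g'' : A ⟶ D'} (hf : f ≫ k = f') (hg : g ≫ k = g') (hf' : f' ≫ k' = f'')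
    (hg' : g' ≫ k' = g'') (hf'' : f ≫ k ≫ k' = f'') (hg'' : g ≫ k ≫ k' = g'') :
    mapHom (mapHom φ k hf hg) k' hf' hg' = mapHom φ (k ≫ k') hf'' hg'' := by
  apply ofHom_injective
  rw [ofHom_mapHom, ofHom_mapHom, ofHom_mapHom, unitMap_comp k k' rfl]
  exact comp_single_comp _ _ _ _ _ _ _ _ _ _ _

end VirtualEquipment

/-! ### Transport of opalgebras along morphisms of loose-monads -/

namespace Opalgebra

variable {X : Type u} [Category.{v} X] {𝕏 : VirtualEquipment.{w, z} X} {A E E' : X} {j : A ⟶ E}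
  {j' : A ⟶ E'} {T : RelativeMonad 𝕏 j} {T' : RelativeMonad 𝕏 j'}

@[ext]
theorem ext_opext {B : X} {x y : Opalgebra T B} (a : x.a = y.a) (opext : HEq x.opext y.opext) :
    x = y := by
  cases x
  cases y
  cases a
  cases opext
  rfl

/-- Precomposition of the opextension operator of an opalgebra with a morphism of loose-monads. -/
noncomputable def pullback {τ : 𝕏.Globular (.single T.looseMonad.t) T'.looseMonad.t}
    (hτ : T.looseMonad.IsHom T'.looseMonad τ) {B : X} (x : Opalgebra T' B) : Opalgebra T B where
  a := x.a
  opext := vcomp τ x.opext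
  unit_opext := by
    have h₁ := comp_single_comp (𝕏 := 𝕏.toVirtualDoubleCategory) (Category.id_comp (𝟙 A))
      (Category.id_comp (𝟙 A)) (Category.id_comp (𝟙 A)) (Category.id_comp (𝟙 A))
      (Category.id_comp (𝟙 A)) (Category.id_comp (𝟙 A)) (Category.id_comp (𝟙 A))
      (Category.id_comp (𝟙 A)) (.single T.looseMonad.unit) τ x.opext
    exact h₁.symm.trans ((congrArg (fun q ↦ vcomp q x.opext) hτ.unit).trans x.unit_opext)
  opext_opext := by
    have i : 𝟙 A ≫ 𝟙 A = 𝟙 A := Category.comp_id _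
    have h₁ := comp_single_comp (𝕏 := 𝕏.toVirtualDoubleCategory) i i i i i i i i
      (.single T.looseMonad.mul) τ x.opext
    have h₂ := comp_single_comp (𝕏 := 𝕏.toVirtualDoubleCategory) i i i i i i i i
      (pair τ τ) T'.looseMonad.mul x.opext
    have h₃ := comp_pair_comp (𝕏 := 𝕏.toVirtualDoubleCategory) rfl rfl i i i i i i i i i
      (.single τ) (.single τ) x.opext x.opext (𝕏.homComp x.a x.a x.a)
    -- Precomposing the opalgebra law with `(τ, τ)` produces `T'`-multiplication after `(τ, τ)`,
    -- which is `T`-multiplication followed by `τ`.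
    refine h₃.trans ?_
    refine (congrArg (gcomp (pair τ τ)) x.opext_opext).trans ?_
    exact h₂.symm.trans ((congrArg (fun q ↦ vcomp q x.opext) hτ.mul).symm.trans h₁)

variable {τ : 𝕏.Globular (.single T.looseMonad.t) T'.looseMonad.t}
  {σ : 𝕏.Globular (.single T'.looseMonad.t) T.looseMonad.t}

theorem pullback_pullback (hτ : T.looseMonad.IsHom T'.looseMonad τ)
    (hσ : T'.looseMonad.IsHom T.looseMonad σ) (h : vcomp τ σ = 𝕏.id T.looseMonad.t) {B : X}
    (x : Opalgebra T B) : (x.pullback hσ).pullback hτ = x := by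
  have i : 𝟙 A ≫ 𝟙 A = 𝟙 A := Category.comp_id _
  refine ext_opext rfl (heq_of_eq ?_)
  have h₁ := comp_single_comp (𝕏 := 𝕏.toVirtualDoubleCategory) i i i i i i i i
    (.single τ) σ x.opext
  exact h₁.symm.trans ((congrArg (fun q ↦ vcomp q x.opext) h).trans (𝕏.id_comp x.opext))

theorem Mediates.pullback (hτ : T.looseMonad.IsHom T'.looseMonad τ) {K B : X}
    {k : Opalgebra T' K} {x : Opalgebra T' B} {c : K ⟶ B} (h : k.Mediates x c) :
    (k.pullback hτ).Mediates (x.pullback hτ) c where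
  tight := h.tight
  opext := (mapHom_gcomp _ _ _ _ _).trans (congrArg (vcomp τ) h.opext)

theorem action_pullback (hτ : T.looseMonad.IsHom T'.looseMonad τ) {B : X}
    (x : Opalgebra T' B) :
    (x.pullback hτ).action = gcomp (.cons rfl τ (.single (𝕏.id (𝕏.hom (𝟙 B) x.a)))) x.action := by
  have i : ∀ Y : X, 𝟙 Y ≫ 𝟙 Y = 𝟙 Y := fun _ ↦ Category.comp_id _
  have h := comp_pair_comp (𝕏 := 𝕏.toVirtualDoubleCategory) rfl rfl (i A) (i A) (i B) (i A) (i B)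
    (i A) (i B) (i A) (i B) (.single τ) (.single (𝕏.id (𝕏.hom (𝟙 B) x.a))) x.opext
    (𝕏.id (𝕏.hom (𝟙 B) x.a)) (𝕏.homComp (𝟙 B) x.a x.a)
  rw [𝕏.comp_id] at h
  exact h

/-- The action of the pulled-back opalgebra is the old action with `τ` applied to the monad
variable, and `α` does not touch that variable. The new compatibility equation is thus the old one
precomposed with `τ`. -/
theorem IsGradedMorphism.pullback (hτ : T.looseMonad.IsHom T'.looseMonad τ) {B B' : X}
    {x : Opalgebra T' B} {x' : Opalgebra T' B'} {p : LoosePath 𝕏.Loose B B'}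
    {α : 𝕏.Globular (.cons (𝕏.hom (𝟙 B) x.a) p) (𝕏.hom (𝟙 B') x'.a)}
    (h : x.IsGradedMorphism x' α) : (x.pullback hτ).IsGradedMorphism (x'.pullback hτ) α := by
  have i : ∀ Y : X, 𝟙 Y ≫ 𝟙 Y = 𝟙 Y := fun _ ↦ Category.comp_id _
  unfold IsGradedMorphism
  rw [action_pullback, action_pullback]
  refine (gcomp_cons_gcomp_ids _ _ _).trans ?_
  refine (congrArg (gcomp (.cons rfl τ (𝕏.ids (.cons (𝕏.hom (𝟙 B) x.a) p)))) h).trans ?_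
  -- Interchange: the row `(τ, α)` is `τ` placed above `α` in `h₁` and `α` placed above `τ` in `h₂`,
  -- padded with identities.
  have h₁ := comp_pair_comp (𝕏 := 𝕏.toVirtualDoubleCategory) rfl rfl (i A) (i A) (i B') (i A)
    (i B') (i A) (i B') (i A) (i B') (.single τ) (𝕏.ids (.cons (𝕏.hom (𝟙 B) x.a) p))
    (𝕏.id T'.looseMonad.t) α x'.action
  have h₂ := comp_pair_comp (𝕏 := 𝕏.toVirtualDoubleCategory)
    (P := .single T.looseMonad.t) (P' := .cons (𝕏.hom (𝟙 B) x.a) p)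
    rfl rfl (i A) (i A) (i B') (i A)
    (i B') (i A) (i B') (i A) (i B') (.single (𝕏.id T.looseMonad.t)) (.single α) τ
    (𝕏.id (𝕏.hom (𝟙 B') x'.a)) x'.action
  have e₁ : 𝕏.comp (i A) (i A) (.single τ) (𝕏.id T'.looseMonad.t) = τ := 𝕏.comp_id τ
  have e₂ : 𝕏.comp (i A) (i B') (𝕏.ids (.cons (𝕏.hom (𝟙 B) x.a) p)) α = α := 𝕏.id_comp α
  have e₃ : 𝕏.comp (i A) (i A) (.single (𝕏.id T.looseMonad.t)) τ = τ := 𝕏.id_comp τ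
  have e₄ : 𝕏.comp (i A) (i B') (.single α) (𝕏.id (𝕏.hom (𝟙 B') x'.a)) = α := 𝕏.comp_id α
  rw [e₁, e₂] at h₁
  rw [e₃, e₄] at h₂
  exact h₁.symm.trans h₂

/-- Opalgebra objects are transported along isomorphisms of loose-monads. -/
theorem IsOpalgebraObject.pullback (hτ : T.looseMonad.IsHom T'.looseMonad τ)
    (hσ : T'.looseMonad.IsHom T.looseMonad σ) (hτσ : vcomp τ σ = 𝕏.id T.looseMonad.t)
    (hστ : vcomp σ τ = 𝕏.id T'.looseMonad.t) {K : X} {k : Opalgebra T K}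
    (hk : k.IsOpalgebraObject) : (k.pullback hσ).IsOpalgebraObject := by
  -- Pulling back along `τ` undoes the pullback along `σ`, so mediation out of the transported
  -- opalgebra is mediation out of `k`.
  have hm : ∀ {B : X} {x : Opalgebra T' B} {c : K ⟶ B}, (k.pullback hσ).Mediates x c →
      k.Mediates (x.pullback hτ) c := fun h ↦ by
    simpa only [pullback_pullback hτ hσ hτσ] using h.pullback hτ
  refine ⟨fun B x ↦ ?_, fun B B' x x' c c' hc hc' p α hα ↦ ?_⟩
  · obtain ⟨c, hc, huniq⟩ := hk.existsUnique_tight (x.pullback hτ)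
    refine ⟨c, ?_, fun d hd ↦ huniq d (hm hd)⟩
    simpa only [pullback_pullback hσ hτ hστ] using hc.pullback hσ
  -- Pulling back leaves underlying tight-cells unchanged definitionally, so `α`, its factorisation
  -- and the restriction along `k.a` are literally the same data.
  · exact hk.existsUnique_cell (x.pullback hτ) (x'.pullback hτ) c c' (hm hc) (hm hc') p α
      (hα.pullback hτ)

theorem Mediates.refl {K : X} (k : Opalgebra T K) : k.Mediates k (𝟙 K) where
  tight := Category.comp_id _
  opext := mapHom_id _

theorem Mediates.trans {K B B' : X} {k : Opalgebra T K} {x : Opalgebra T B} {y : Opalgebra T B'}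
    {c : K ⟶ B} {d : B ⟶ B'} (hc : k.Mediates x c) (hd : x.Mediates y d) :
    k.Mediates y (c ≫ d) where
  tight := by rw [← Category.assoc, hc.tight, hd.tight]
  opext := by
    rw [← mapHom_mapHom k.opext c d hc.tight hc.tight hd.tight hd.tight, hc.opext, hd.opext]

/-- Any two opalgebra objects for a relative monad are isomorphic. -/
theorem IsOpalgebraObject.exists_iso {K K' : X} {k : Opalgebra T K} {k' : Opalgebra T K'}
    (hk : k.IsOpalgebraObject) (hk' : k'.IsOpalgebraObject) :
    ∃ e : K' ≅ K, k'.a ≫ e.hom = k.a := by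
  obtain ⟨c, hc, -⟩ := hk.existsUnique_tight k'
  obtain ⟨d, hd, -⟩ := hk'.existsUnique_tight k
  -- Each composite mediates an opalgebra object to itself, as does the identity.
  exact ⟨⟨d, c, (hk'.existsUnique_tight k').unique (hd.trans hc) (.refl k'),
    (hk.existsUnique_tight k).unique (hc.trans hd) (.refl k)⟩, hd.tight⟩

end Opalgebra

/-- The carriers and units agree by definition; the multiplications differ by a row of identities,
coming from the identity extension operator. -/
theorem RelativeMonad.looseMonad_trivial {X : Type u} [Category.{v} X]
    {𝕏 : VirtualEquipment.{w, z} X} {A C : X} (l : A ⟶ C) :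
    (RelativeMonad.trivial 𝕏 l).looseMonad = 𝕏.looseMonad l := by
  unfold RelativeMonad.looseMonad VirtualEquipment.looseMonad
  congr 1
  exact 𝕏.id_comp (𝕏.homComp l l l)

/-! ### The loose-monad of a resolution -/

namespace RelativeAdjunction

variable {X : Type u} [Category.{v} X] {𝕏 : VirtualEquipment.{w, z} X} {A C E : X} {j : A ⟶ E}
  {l : A ⟶ C} {r : C ⟶ E}

/-- The left action `E(j, r), C(1, 1) ⇒ E(j, r)` of the loose-identity of `C`. -/
noncomputable def unitAction (𝕏 : VirtualEquipment.{w, z} X) (j : A ⟶ E) (r : C ⟶ E) :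
    𝕏.Globular (.cons (𝕏.unit C) (.single (𝕏.hom j r))) (𝕏.hom j r) :=
  toHom (hcomp rfl (𝕏.unitMap r) (𝕏.homCell j r))

theorem unitCell_unitAction :
    gcomp (pair (𝕏.unitCell C) (𝕏.id (𝕏.hom j r))) (unitAction 𝕏 j r) = 𝕏.id (𝕏.hom j r) := by
  apply ofHom_injective
  rw [ofHom_gcomp, unitAction, ofHom_toHom, ofHom_id]
  refine (comp_pair_hcomp rfl _ (Category.id_comp r) _ _ _ _ _).trans ?_
  rw [unitCell_unitMap]
  exact (congrArg (hcomp rfl (𝕏.tightId r)) (𝕏.id_comp (𝕏.homCell j r))).trans (tightId_hcomp _)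

/-- Every 2-cell out of `E(j, r)` is compatible with the left actions of the loose-identity. -/
theorem unitAction_comp (φ : 𝕏.Cell (𝟙 C) l (.single (𝕏.hom j r)) (𝕏.unit C)) :
    𝕏.comp (Category.id_comp (𝟙 C)) (Category.id_comp l) (.single (unitAction 𝕏 j r)) φ =
      hcomp rfl (𝕏.id (𝕏.unit C)) φ := by
  -- After the unit of `C` is inserted, both sides reduce to `φ`: the left by unitality of the
  -- action, the right by unitality of horizontal composition.
  apply unitCell_injective
  have h₁ := comp_single_comp (Category.id_comp (𝟙 C)) (Category.id_comp (𝟙 A))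
    (Category.id_comp (𝟙 C)) (Category.id_comp l) (Category.id_comp (𝟙 C)) (Category.id_comp l)
    (Category.id_comp (𝟙 C)) (Category.id_comp l)
    (pair (𝕏.unitCell C) (𝕏.id (𝕏.hom j r))) (unitAction 𝕏 j r) φ
  have h₂ := comp_pair_hcomp (S := .single (𝕏.hom j r)) rfl (Category.id_comp (𝟙 C))
    (Category.id_comp (𝟙 C)) (Category.id_comp l) (𝕏.unitCell C) (𝕏.id (𝕏.hom j r))
    (𝕏.id (𝕏.unit C)) φ
  have e : 𝕏.comp (Category.id_comp (𝟙 C)) (Category.id_comp (𝟙 C)) (.single (𝕏.unitCell C))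
      (𝕏.id (𝕏.unit C)) = 𝕏.tightId (𝟙 C) :=
    (𝕏.comp_id (𝕏.unitCell C)).trans (𝕏.id_comp (𝕏.unitCell C)).symm
  have e' : 𝕏.comp (Category.id_comp (𝟙 C)) (Category.id_comp l)
      (.single (𝕏.id (𝕏.hom j r))) φ = φ := 𝕏.id_comp φ
  rw [e, e', tightId_hcomp] at h₂
  refine h₁.symm.trans (Eq.trans ?_ h₂.symm)
  exact (congrArg (fun q ↦ 𝕏.comp (Category.id_comp (𝟙 C)) (Category.id_comp l) (.single q) φ)
    unitCell_unitAction).trans e'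

/-- The restriction of `♭` along `l` preserves multiplication. -/
theorem mul_restrictAlong {t : A ⟶ E} (ht : l ≫ r = t)
    (φ : 𝕏.Globular (.single (𝕏.hom j r)) (𝕏.hom l (𝟙 C)))
    {τ : 𝕏.Globular (.single (𝕏.hom j t)) (𝕏.hom l l)}
    (hτ : τ = restrictAlong l ht (Category.comp_id l) φ) :
    vcomp (gcomp (pair (mapHom τ r ht ht) (𝕏.id (𝕏.hom j t))) (𝕏.homComp j t t)) τ =
      gcomp (pair τ τ) (𝕏.homComp l l l) := by
  have hτ' : ofHom τ = 𝕏.comp (Category.comp_id l) (Category.id_comp l)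
      (.single (homRestr l r j ht)) (ofHom φ) := by
    rw [hτ, ofHom_restrictAlong]
    rfl
  -- Modulo the cartesian 2-cell `E(j, t) ⇒ E(j, r)`, the multiplication is `τ` in the first
  -- variable followed by the action of `C(1, 1)`. Both sides apply `r` to `τ` and compose in `E`,
  -- which is seen after composing with `homCell j r`.
  have hm : 𝕏.comp (Category.id_comp l) (Category.id_comp (𝟙 A))
      (.single (gcomp (pair (mapHom τ r ht ht) (𝕏.id (𝕏.hom j t))) (𝕏.homComp j t t)))
      (homRestr l r j ht) =
      𝕏.comp (Category.comp_id l) (Category.id_comp (𝟙 A))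
        (.cons rfl (ofHom τ) (.single (homRestr l r j ht))) (unitAction 𝕏 j r) := by
    apply homCell_injective ht (Category.id_comp j)
    rw [comp_single_comp (Category.id_comp l) (Category.id_comp (𝟙 A)) ht (Category.id_comp j)
      ht (Category.id_comp j) (Category.id_comp t) (Category.id_comp j)]
    rw [comp_single_comp (Category.comp_id l) (Category.id_comp (𝟙 A)) ht (Category.id_comp j)
      (Category.id_comp r) (Category.id_comp j) ht (Category.id_comp j)]
    have h₁ : 𝕏.comp ht (Category.id_comp j) (.single (homRestr l r j ht)) (𝕏.homCell j r) =
      𝕏.homCell j t := lift_homCell _ _ _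
    have h₂ := ofHom_pair_homComp (mapHom τ r ht ht) (𝕏.id (𝕏.hom j t))
    have h₃ : 𝕏.comp (Category.id_comp r) (Category.id_comp j) (.single (unitAction 𝕏 j r))
        (𝕏.homCell j r) = hcomp rfl (𝕏.unitMap r) (𝕏.homCell j r) := ofHom_toHom _
    rw [h₁, h₃]
    refine h₂.trans ?_
    rw [ofHom_mapHom, ofHom_id]
    rw [comp_pair_hcomp rfl ht ht (Category.id_comp j), h₁]
  apply ofHom_injective
  rw [ofHom_pair_homComp, ofHom_gcomp]
  have h₁ := comp_single_comp (Category.id_comp l) (Category.id_comp (𝟙 A)) (Category.comp_id l)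
    (Category.id_comp l) (Category.comp_id l) (Category.id_comp l) (Category.id_comp l)
    (Category.id_comp l)
    (.single (gcomp (pair (mapHom τ r ht ht) (𝕏.id (𝕏.hom j t))) (𝕏.homComp j t t)))
    (homRestr l r j ht) (ofHom φ)
  rw [hm, ← hτ'] at h₁
  refine h₁.symm.trans ?_
  -- Now `φ` passes through the action onto the second variable, where with `homRestr` it forms the
  -- second copy of `τ`.
  rw [comp_single_comp (Category.comp_id l) (Category.id_comp (𝟙 A)) (Category.comp_id l)
    (Category.id_comp l) (Category.id_comp (𝟙 C)) (Category.id_comp l) (Category.comp_id l)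
    (Category.id_comp l), unitAction_comp]
  rw [comp_pair_hcomp rfl (Category.comp_id l) (Category.comp_id l) (Category.id_comp l),
    𝕏.comp_id, ← hτ']

/-- The loose-monad of a relative monad with a resolution is induced by the left adjoint. -/
theorem IsResolution.isInducedBy {adj : RelativeAdjunction 𝕏 j l r} {T : RelativeMonad 𝕏 j}
    (h : adj.IsResolution T) : T.looseMonad.IsInducedBy l := by
  have i : 𝟙 A ≫ 𝟙 A = 𝟙 A := Category.comp_id _
  let τ : 𝕏.Globular (.single (𝕏.hom j T.t)) (𝕏.hom l l) :=
    restrictAlong l h.tight (Category.comp_id l) adj.flat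
  let σ : 𝕏.Globular (.single (𝕏.hom l l)) (𝕏.hom j T.t) :=
    restrictAlong l (Category.comp_id l) h.tight adj.sharp
  have hτσ : vcomp τ σ = 𝕏.id (𝕏.hom j T.t) := by
    rw [← restrictAlong_vcomp, adj.flat_sharp, restrictAlong_id]
  have hστ : vcomp σ τ = 𝕏.id (𝕏.hom l l) := by
    rw [← restrictAlong_vcomp, adj.sharp_flat, restrictAlong_id]
  -- The unit of the induced relative monad is defined through `♯`, so it is `σ` that visibly
  -- preserves units; the statement for `τ` follows by inverting.
  have hu : vcomp (𝕏.homUnit l) σ = toHom T.unit := by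
    rw [← h.unit]
    exact ofHom_injective (ofHom_toHom _).symm
  have hm : vcomp T.looseMonad.mul τ = gcomp (pair τ τ) (𝕏.homComp l l l) := by
    have := mul_restrictAlong h.tight adj.flat (τ := τ) rfl
    have he : mapHom τ r h.tight h.tight = T.ext := h.ext
    rw [he] at this
    exact this
  have hτ : T.looseMonad.IsHom (𝕏.looseMonad l) τ := by
    refine ⟨?_, hm⟩
    have h₁ := comp_single_comp (𝕏 := 𝕏.toVirtualDoubleCategory) i i i i i i i i
      (.single (𝕏.homUnit l)) σ τ
    exact (congrArg (fun q ↦ vcomp q τ) hu).symm.trans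
      (h₁.trans ((congrArg (vcomp (𝕏.homUnit l)) hστ).trans (𝕏.comp_id _)))
  exact ⟨τ, σ, hτ, hτ.inverse hτσ hστ, hτσ, hστ⟩

end RelativeAdjunction

theorem mainTheorem9 {X : Type u} [Category.{v} X] (𝕏 : VirtualEquipment.{w, z} X) {A E : X}
    (j : A ⟶ E) (T : RelativeMonad 𝕏 j) :
    (∀ ⦃C : X⦄ (l : A ⟶ C), T.looseMonad.IsInducedBy l →
      (T.AdmitsOpalgebraObject ↔ (RelativeMonad.trivial 𝕏 l).AdmitsOpalgebraObject) ∧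
      ∀ ⦃K K' : X⦄ (k : Opalgebra T K) (k' : Opalgebra (RelativeMonad.trivial 𝕏 l) K'),
        k.IsOpalgebraObject → k'.IsOpalgebraObject → ∃ e : K' ≅ K, k'.a ≫ e.hom = k.a) ∧
    (∀ ⦃C : X⦄ (l : A ⟶ C) (r : C ⟶ E) (adj : RelativeAdjunction 𝕏 j l r),
      adj.IsResolution T → T.looseMonad.IsInducedBy l) := by
  refine ⟨fun C l hl ↦ ?_, fun C l r adj h ↦ h.isInducedBy⟩
  unfold LooseMonad.IsInducedBy at hl
  -- This puts both sides of the isomorphism in the form of loose-monads of relative monads, as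
  -- transport of opalgebras requires.
  rw [← RelativeMonad.looseMonad_trivial] at hl
  obtain ⟨τ, σ, hτ, hσ, hτσ, hστ⟩ := hl
  refine ⟨⟨fun ⟨K, k, hk⟩ ↦ ⟨K, k.pullback hσ, hk.pullback hτ hσ hτσ hστ⟩,
    fun ⟨K, k, hk⟩ ↦ ⟨K, k.pullback hτ, hk.pullback hσ hτ hστ hτσ⟩⟩, fun K K' k k' hk hk' ↦ ?_⟩
  -- The transported `k'` is a second opalgebra object for `T` with the same underlying tight-cell
  -- as `k'`.
  exact hk.exists_iso (hk'.pullback hσ hτ hστ hτσ)
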